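/- Let $M\ge 1$ and $n>M$ be integers. For data $\mathbf x^n=(\mathbf x_1,\dots,\mathbf x_n)$ in $\mathbb R^M$ put $\hat{\boldsymbol\mu}_n=\frac1n\sum_{i\le n}\mathbf x_i$ and $\hat\Sigma_n=\sum_{i\le n}(\mathbf x_i-\hat{\boldsymbol\mu}_n)(\mathbf x_i-\hat{\boldsymbol\mu}_n)^T$; $\hat\Sigma_{n+1}$ is formed in the same way from $\mathbf x_1,\dots,\mathbf x_{n+1}$. Let $f(\mathbf x\mid\boldsymbol\mu,\Sigma)$ be the density of $\mathcal N(\boldsymbol\mu,\Sigma)$ for $\Sigma>0$ (symmetric positive definite), $f(\mathbf x^n\mid\boldsymbol\mu,\Sigma)=\prod_{i\le n} f(\mathbf x_i\mid\boldsymbol\mu,\Sigma)$, let $d\Sigma=\prod_{i\le j}d\Sigma_{ij}$ on symmetric matrices, and $\Gamma_M(a)=\int_{V>0}\det(V)^{a-\frac{M+1}2}e^{-\operatorname{tr}V}\,dV$. The Wishart law $\mathcal W_M(I,k)$ is the law of $\sum_{i\le k}\mathbf z_i\mathbf z_i^T$ with $\mathbf z_i$ iid $\mathcal N(0,I)$,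 and the inverse Wishart law $\mathcal W_M^{-1}(\Psi,\nu)$ has density $\frac{\det(\Psi)^{\nu/2}}{2^{M\nu/2}\Gamma_M(\nu/2)}\det(\Sigma)^{-\frac{\nu+M+1}2}e^{-\frac12\operatorname{tr}(\Psi\Sigma^{-1})}$ on $\Sigma>0$ with respect to $d\Sigma$. **(a) Model and sufficient statistic.** If $\mathbf x_1,\dots,\mathbf x_n$ are iid $\mathcal N(\boldsymbol\mu,\Sigma)$ with $\Sigma>0$, then $\mathbf x^n$ has density $f(\mathbf x^n\mid\boldsymbol\mu,\Sigma)$ and $\hat\Sigma_n>0$ almost surely. The pair $(\hat{\boldsymbol\mu}_n,\hat\Sigma_n)$ is a sufficient statistic for $(\boldsymbol\mu,\Sigma)$, $\Sigma>0$. For every square matrix $S$ with $SS^T=\Sigma$ it has the same law as $(\boldsymbol\mu+\frac1{\sqrt n}S\mathbf z,\;SUS^T)$, where $\mathbf z\sim\mathcal N(0,I)$ and $U\sim\mathcal W_M(I,n-1)$ are independent. **(b) Sufficient statistic method.** Fix data $\mathbf x^n$ with $\hat\Sigma_n>0$ and any square matrix $\hat S_n$ with $\hat S_n\hat S_n^T=\hat\Sigma_n$.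 Let $\mathbf z,U$ be as in (a), let $U^{-1/2}$ be the positive semidefinite square root of $U^{-1}$, and put $S=\hat S_nU^{-1/2}$, $$\Sigma=\hat S_nU^{-1}\hat S_n^T,\qquad \boldsymbol\mu=\hat{\boldsymbol\mu}_n-\tfrac1{\sqrt n}S\mathbf z .$$ Almost surely $U>0$, $\Sigma>0$, $SS^T=\Sigma$, and $(\boldsymbol\mu,S)$ solves $\hat{\boldsymbol\mu}_n=\boldsymbol\mu+\frac1{\sqrt n}S\mathbf z$, $\hat\Sigma_n=SUS^T$. The law $P_{\mathbf x^n}$ of $(\boldsymbol\mu,\Sigma)$ is a probability measure such that $$\Sigma\sim\mathcal W_M^{-1}(\hat\Sigma_n,n-1),\qquad \boldsymbol\mu\mid\Sigma\sim\mathcal N\big(\hat{\boldsymbol\mu}_n,\tfrac1n\Sigma\big),$$ and on $\mathbb R^M\times\{\Sigma>0\}$ it has the joint density $f_{\mathbf x^n}(\boldsymbol\mu,\Sigma)$ with respect to $d\boldsymbol\mu\,d\Sigma$ that is the product of the $\mathcal N(\hat{\boldsymbol\mu}_n,\frac1n\Sigma)$ density at $\boldsymbol\mu$ and the $\mathcal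 W_M^{-1}(\hat\Sigma_n,n-1)$ density at $\Sigma$. For every $\mathbf x_{n+1}\in\mathbb R^M$ the function $(\boldsymbol\mu,\Sigma)\mapsto f(\mathbf x_{n+1}\mid\boldsymbol\mu,\Sigma)$ is $P_{\mathbf x^n}$-integrable, and the predictive density $f(\mathbf x_{n+1}\mid\mathbf x^n)=\int f(\mathbf x_{n+1}\mid\boldsymbol\mu,\Sigma)\,dP_{\mathbf x^n}(\boldsymbol\mu,\Sigma)$ equals $$\pi^{-M/2}\Big(\frac n{n+1}\Big)^{M/2}\frac{\det(\hat\Sigma_n)^{\frac{n-1}2}}{\det(\hat\Sigma_{n+1})^{\frac n2}}\cdot\frac{\Gamma_M(\frac n2)}{\Gamma_M(\frac{n-1}2)} .$$ **(c) Normalized likelihood method (NLM).** Let $n>2M+1$ and fix data $\mathbf x^n$ with $\hat\Sigma_n>0$. Then $C(\mathbf x^n)=\int_{\Sigma>0}\int f(\mathbf x^n\mid\boldsymbol\mu,\Sigma)\,d\boldsymbol\mu\,d\Sigma$ is finite and positive, and for every $\mathbf x_{n+1}\in\mathbb R^M$ the predictive density $$f(\mathbf x_{n+1}\mid\mathbf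 x^n)=\int_{\Sigma>0}\int f(\mathbf x_{n+1}\mid\boldsymbol\mu,\Sigma)\,\frac{f(\mathbf x^n\mid\boldsymbol\mu,\Sigma)}{C(\mathbf x^n)}\,d\boldsymbol\mu\,d\Sigma$$ is given by a convergent integral and equals $C(\mathbf x^{n+1})/C(\mathbf x^n)$ and $$\pi^{-M/2}\Big(\frac n{n+1}\Big)^{M/2}\frac{\det(\hat\Sigma_n)^{\frac{n-1}2-\frac{M+1}2}}{\det(\hat\Sigma_{n+1})^{\frac n2-\frac{M+1}2}}\cdot\frac{\Gamma_M(\frac{n-M-1}2)}{\Gamma_M(\frac{n-M-2}2)} .$$ -/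

import Mathlib

open MeasureTheory ProbabilityTheory
open scoped MatrixOrder

noncomputable section

namespace VecGauss

/-- Column vectors in `ℝ^M` with the Euclidean structure. -/
abbrev Vec (M : ℕ) := EuclideanSpace ℝ (Fin M)

/-- Real `M × M` matrices. -/
abbrev Mat (M : ℕ) := Matrix (Fin M) (Fin M) ℝ

/-- Matrices carry the product (entrywise Borel) σ-algebra. -/
instance instMeasurableSpaceMat (M : ℕ) : MeasurableSpace (Mat M) :=
  inferInstanceAs (MeasurableSpace (Fin M → Fin M → ℝ))

instance instBorelSpaceMat (M : ℕ) : BorelSpace (Mat M) :=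
  inferInstanceAs (BorelSpace (Fin M → Fin M → ℝ))

/-- The symmetric matrix with prescribed entries on and above the diagonal. -/
def symOfUpper {M : ℕ} (v : {p : Fin M × Fin M // p.1 ≤ p.2} → ℝ) : Mat M :=
  Matrix.of fun i j => v ⟨(min i j, max i j), min_le_max⟩

/-- The measure `dΣ = ∏_{i ≤ j} dΣ_{ij}` on symmetric matrices,
as a measure on the space of all matrices. -/
def symLebesgue (M : ℕ) : Measure (Mat M) :=
  (volume : Measure ({p : Fin M × Fin M // p.1 ≤ p.2} → ℝ)).map symOfUpper

/-- The measure `dΣ` restricted to the cone `Σ > 0`. -/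
def posDefLebesgue (M : ℕ) : Measure (Mat M) :=
  (symLebesgue M).restrict {S | S.PosDef}

instance instSFinitePosDefLebesgue (M : ℕ) : SFinite (posDefLebesgue M) := by
  unfold posDefLebesgue symLebesgue
  infer_instance

/-- The measure `dμ dΣ` on the parameter space `ℝ^M × {Σ > 0}`. -/
def paramLebesgue (M : ℕ) : Measure (Vec M × Mat M) :=
  (volume : Measure (Vec M)).prod (posDefLebesgue M)

/-- `etr A = exp (trace A)`. -/
def etr {M : ℕ} (A : Mat M) : ℝ := Real.exp A.trace

/-- The multivariate gamma function
`Γ_M(a) = ∫_{V > 0} det(V)^(a - (M+1)/2) etr(-V) dV`. -/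
def multiGamma (M : ℕ) (a : ℝ) : ℝ :=
  ∫ V, V.det ^ (a - ((M : ℝ) + 1) / 2) * etr (-V) ∂(posDefLebesgue M)

/-- The outer product `v vᵀ`. -/
def outer {M : ℕ} (v : Vec M) : Mat M := Matrix.vecMulVec v.ofLp v.ofLp

/-- The density of `N(m, S)` on `ℝ^M` (for `S > 0`). -/
def gaussDensity {M : ℕ} (m : Vec M) (S : Mat M) (y : Vec M) : ℝ :=
  1 / Real.sqrt ((2 * Real.pi) ^ M * S.det) *
    Real.exp (-(1 / 2) * ((y - m).ofLp ⬝ᵥ S⁻¹.mulVec (y - m).ofLp))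

/-- The law of `n` iid vectors with distribution `N(m, S)`. -/
def sampleLaw (M n : ℕ) (m : Vec M) (S : Mat M) : Measure (Fin n → Vec M) :=
  Measure.pi fun _ => multivariateGaussian m S

/-- The likelihood `f(x^n | μ, Σ)` of `n` iid vectors. -/
def likelihood {M n : ℕ} (x : Fin n → Vec M) (m : Vec M) (S : Mat M) : ℝ :=
  ∏ i, gaussDensity m S (x i)

/-- `μ̂_n = (1/n) ∑ x_i`. -/
def muHat {M n : ℕ} (x : Fin n → Vec M) : Vec M := (n : ℝ)⁻¹ • ∑ i, x i

/-- `Σ̂_n = ∑ (x_i - μ̂_n)(x_i - μ̂_n)ᵀ` (unnormalised). -/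
def sigmaHat {M n : ℕ} (x : Fin n → Vec M) : Mat M := ∑ i, outer (x i - muHat x)

/-- The data `x_1, …, x_n` followed by `x_{n+1} = y`. -/
def extend {M n : ℕ} (x : Fin n → Vec M) (y : Vec M) : Fin (n + 1) → Vec M :=
  Fin.snoc (α := fun _ => Vec M) x y

/-- A statistic `t` is sufficient for the family `P` if the conditional law of the data given `t`
can be chosen independently of the parameter. -/
def IsSufficient {Θ X T : Type*} [MeasurableSpace X] [MeasurableSpace T]
    (P : Θ → Measure X) (t : X → T) : Prop :=
  Measurable t ∧ ∃ κ : Kernel T X, IsMarkovKernel κ ∧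
    ∀ θ, (P θ).map (fun x => (t x, x)) = ((P θ).map t).compProd κ

/-- The Wishart distribution `W_M(V, k)`: the law of `∑_{i ≤ k} z_i z_iᵀ` with `z_i` iid `N(0, V)`. -/
def wishart {M : ℕ} (V : Mat M) (k : ℕ) : Measure (Mat M) :=
  (Measure.pi fun _ : Fin k => multivariateGaussian (0 : Vec M) V).map
    fun z => ∑ i, outer (z i)

/-- The density of the inverse Wishart distribution `W_M⁻¹(Ψ, ν)` with respect to `dΣ`. -/
def invWishartDensity {M : ℕ} (Psi : Mat M) (ν : ℝ) (S : Mat M) : ℝ :=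
  Psi.det ^ (ν / 2) / (2 ^ ((M : ℝ) * ν / 2) * multiGamma M (ν / 2)) *
    S.det ^ (-((ν + (M : ℝ) + 1) / 2)) * etr (-(1 / 2 : ℝ) • (Psi * S⁻¹))

/-- The inverse Wishart distribution `W_M⁻¹(Ψ, ν)` (for `Ψ > 0` and `ν > M - 1`). -/
def invWishart {M : ℕ} (Psi : Mat M) (ν : ℝ) : Measure (Mat M) :=
  (posDefLebesgue M).withDensity fun S => ENNReal.ofReal (invWishartDensity Psi ν S)

/-- The statistic as a function of the pivot `(z, U)` and the parameters, `S` being a square root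
of `Σ`: `(μ̂, Σ̂) = (μ + S z / √n, S U Sᵀ)`. -/
def ssmStatistic {M : ℕ} (n : ℕ) (m : Vec M) (S : Mat M) (p : Vec M × Mat M) : Vec M × Mat M :=
  (m + (Real.sqrt n)⁻¹ • Matrix.toEuclideanLin S p.1, S * p.2 * S.transpose)

/-- The law of the pivot: `z ~ N(0, I)` and `U ~ W_M(I, n - 1)`, independent. -/
def pivotLaw (M n : ℕ) : Measure (Vec M × Mat M) :=
  (stdGaussian (Vec M)).prod (wishart (1 : Mat M) (n - 1))

/-- The solution `S = Ŝ U^{-1/2}` for the square root `S` of `Σ`, where `Ŝ` is a square root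
of `Σ̂` and `U^{-1/2}` is the positive semidefinite square root of `U⁻¹`. -/
def ssmRoot {M : ℕ} (Shat : Mat M) (U : Mat M) : Mat M := Shat * CFC.sqrt U⁻¹

/-- The parameters as a function of the pivot `(z, U)` and the statistic:
`μ = μ̂ - Ŝ U^{-1/2} z / √n` and `Σ = Ŝ U⁻¹ Ŝᵀ`. -/
def ssmSolution {M : ℕ} (n : ℕ) (mhat : Vec M) (Shat : Mat M) (p : Vec M × Mat M) :
    Vec M × Mat M :=
  (mhat - (Real.sqrt n)⁻¹ • Matrix.toEuclideanLin (ssmRoot Shat p.2) p.1,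
    Shat * p.2⁻¹ * Shat.transpose)

/-- The distribution that the sufficient statistic method puts on `(μ, Σ)`. -/
def ssmLaw {M : ℕ} (n : ℕ) (mhat : Vec M) (Shat : Mat M) : Measure (Vec M × Mat M) :=
  (pivotLaw M n).map (ssmSolution n mhat Shat)

instance instIsFiniteMeasureSsmLaw {M : ℕ} (n : ℕ) (mhat : Vec M) (Shat : Mat M) :
    IsFiniteMeasure (ssmLaw n mhat Shat) := by
  unfold ssmLaw pivotLaw wishart
  infer_instance

/-- The predictive density `∫ f(y | θ) f_{x^n}(θ) dθ` of the sufficient statistic method. -/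
def ssmPredictive {M : ℕ} (n : ℕ) (mhat : Vec M) (Shat : Mat M) (y : Vec M) : ℝ :=
  ∫ θ, gaussDensity θ.1 θ.2 y ∂(ssmLaw n mhat Shat)

/-- `C(x^n) = ∫_{Σ > 0} ∫ f(x^n | μ, Σ) dμ dΣ`. -/
def nlmC {M n : ℕ} (x : Fin n → Vec M) : ℝ :=
  ∫ θ, likelihood x θ.1 θ.2 ∂(paramLebesgue M)

/-- The normalised likelihood `f_{x^n}(μ, Σ) = f(x^n | μ, Σ) / C(x^n)`. -/
def nlmDensity {M n : ℕ} (x : Fin n → Vec M) (θ : Vec M × Mat M) : ℝ :=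
  likelihood x θ.1 θ.2 / nlmC x

/-- The predictive density `∫ f(y | θ) f_{x^n}(θ) dθ` of the normalised likelihood method. -/
def nlmPredictive {M n : ℕ} (x : Fin n → Vec M) (y : Vec M) : ℝ :=
  ∫ θ, gaussDensity θ.1 θ.2 y * nlmDensity x θ ∂(paramLebesgue M)

end VecGauss

end

/-!
The explicit densities come from one algebraic identity for the likelihood and from the uniqueness
of invariant measures on the cone of positive definite matrices.

The quadratic form in the exponent of the likelihood splits into a function of `Σ̂` and a function
of `μ̂ - μ` (`sum_dotProduct_sub`). Hence the likelihood depends on the data through the statistic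
only, which gives sufficiency by the factorisation criterion (`isSufficient_of_withDensity`), and
as a function of the parameters it is, up to a power of `det Σ`, a multiple of the
normal-inverse-Wishart density (`likelihood_mul_det_rpow`). Mixing a standard Gaussian sample by
an orthogonal matrix with constant first row leaves its law unchanged and turns the mean and the
scatter matrix into functions of disjoint sets of observations
(`map_muHat_sigmaHat_pi_stdGaussian`); this is the law of the statistic in terms of the pivot.

The Wishart and inverse Wishart densities are obtained without matrix factorisations. A measure on
the cone of positive definite matrices that is invariant under all congruences `V ↦ A V Aᵀ` is
unique up to a factor: a Fubini argument compares it with the image of Haar measure of the linear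
group under `A ↦ A Aᵀ` (`lintegral_mul_lintegral_haarGL`, `IsCongrInvariant.exists_smul_eq`). The
measure `det(V)^(-(M+1)/2) dV` is invariant, because the congruence by `A` has Jacobian
`|det A|^(M+1)` on symmetric matrices (`det_congrLin`). So is its image under inversion, hence inversion
preserves it (`lintegral_inv_invMeasure`); and so is `det^(-k/2)` times the image of Lebesgue
measure under `Z ↦ Z Zᵀ`, which identifies the Wishart law up to a constant
(`exists_lintegral_wishart`). The constant follows from the total mass being one, and it also
shows that `Γ_M(k/2)` is finite and positive for `k ≥ M` (`multiGamma_half`); no other values of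
`Γ_M` occur.

With `U` Wishart, `Ŝ U⁻¹ Ŝᵀ` is then inverse Wishart (`lintegral_wishart_inv`), which
disintegrates the law of the parameters (`lintegral_ssmLaw`). Both predictive densities are ratios
of total masses of likelihoods of `n + 1` and `n` observations, weighted by the same power of
`det Σ`: the exponent `-(M+1)/2` for the sufficient statistic method and `0` for the normalised
likelihood (`integrable_predictive`, `likelihoodMass_div`).
-/

noncomputable section

namespace VecGauss

instance instSecondCountableTopologyMat (M : ℕ) : SecondCountableTopology (Mat M) :=
  inferInstanceAs (SecondCountableTopology (Fin M → Fin M → ℝ))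

variable {M n k : ℕ}

/-! ### Scatter matrices -/

/-- The sum of outer products `∑ zᵢ zᵢᵀ`. -/
def gram (Z : Fin k → Vec M) : Mat M := ∑ i, outer (Z i)

/-- The matrix whose rows are the given vectors. -/
def rowMat (Z : Fin k → Vec M) : Matrix (Fin k) (Fin M) ℝ := Matrix.of fun i j => Z i j

/-- The linear map of a matrix, applied to each vector of a family. -/
def mapVecs (A : Mat M) (Z : Fin k → Vec M) : Fin k → Vec M :=
  fun i => Matrix.toEuclideanLin A (Z i)

lemma outer_toEuclideanLin (A : Mat M) (v : Vec M) :
    outer (Matrix.toEuclideanLin A v) = A * outer v * A.transpose := by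
  simp [outer, Matrix.mul_vecMulVec, Matrix.vecMulVec_mul, Matrix.toLpLin_apply,
    Matrix.vecMul_transpose]

lemma outer_smul (c : ℝ) (v : Vec M) : outer (c • v) = c ^ 2 • outer v := by
  ext i j
  simp [outer, Matrix.vecMulVec_apply]
  ring

lemma trace_mul_outer (B : Mat M) (v : Vec M) :
    (B * outer v).trace = v.ofLp ⬝ᵥ B.mulVec v.ofLp := by
  rw [outer, Matrix.mul_vecMulVec, Matrix.trace_vecMulVec, dotProduct_comm]

lemma trace_outer (v : Vec M) : (outer v).trace = ‖v‖ ^ 2 := by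
  rw [outer, Matrix.trace_vecMulVec, EuclideanSpace.real_norm_sq_eq]
  simp [dotProduct, pow_two]

lemma gram_mapVecs (A : Mat M) (Z : Fin k → Vec M) :
    gram (mapVecs A Z) = A * gram Z * A.transpose := by
  simp [gram, mapVecs, outer_toEuclideanLin, Finset.mul_sum, Finset.sum_mul]

lemma gram_eq_transpose_mul (Z : Fin k → Vec M) :
    gram Z = (rowMat Z).transpose * rowMat Z := by
  ext i j
  simp [gram, rowMat, outer, Matrix.sum_apply, Matrix.mul_apply, Matrix.vecMulVec_apply]

lemma rowMat_mapVecs (A : Mat M) (Z : Fin k → Vec M) :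
    rowMat (mapVecs A Z) = rowMat Z * A.transpose := by
  ext i j
  simp [rowMat, mapVecs, Matrix.mul_apply, Matrix.toLpLin_apply, Matrix.mulVec, dotProduct,
    mul_comm]

lemma trace_gram (Z : Fin k → Vec M) : (gram Z).trace = ∑ i, ‖Z i‖ ^ 2 := by
  simp [gram, Matrix.trace_sum, trace_outer]

lemma posSemidef_gram (Z : Fin k → Vec M) : (gram Z).PosSemidef := by
  rw [gram_eq_transpose_mul, ← Matrix.conjTranspose_eq_transpose_of_trivial]
  exact Matrix.posSemidef_conjTranspose_mul_self _

lemma sum_sub_muHat (hn : n ≠ 0) (x : Fin n → Vec M) : ∑ i, (x i - muHat x) = 0 := by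
  have : (n : ℝ) ≠ 0 := by exact_mod_cast hn
  simp [muHat, ← Nat.cast_smul_eq_nsmul ℝ, smul_smul, this]

/-- The decomposition of the scatter about an arbitrary centre into the scatter about the mean
and the displacement of the mean. -/
lemma sum_outer_sub (hn : n ≠ 0) (x : Fin n → Vec M) (m : Vec M) :
    ∑ i, outer (x i - m) = sigmaHat x + (n : ℝ) • outer (muHat x - m) := by
  have h0 := sum_sub_muHat hn x
  have h (a : Fin M) : ∑ i, (x i a - muHat x a) = 0 := by
    simpa using congrArg (fun v : Vec M => v a) h0
  ext a b
  have : ∀ i, (x i a - m a) * (x i b - m b) = (x i a - muHat x a) * (x i b - muHat x b)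
      + (x i a - muHat x a) * (muHat x b - m b) + (muHat x a - m a) * (x i b - muHat x b)
      + (muHat x a - m a) * (muHat x b - m b) := fun i => by ring
  simp only [sigmaHat, outer, Matrix.sum_apply, Matrix.add_apply, Matrix.smul_apply,
    Matrix.vecMulVec_apply, WithLp.ofLp_sub, Pi.sub_apply, this, Finset.sum_add_distrib,
    ← Finset.sum_mul, ← Finset.mul_sum, h]
  simp
  ring

/-- The quadratic form in the exponent of the likelihood depends on the data only through the
mean and the scatter matrix. -/
lemma sum_dotProduct_sub (hn : n ≠ 0) (x : Fin n → Vec M) (m : Vec M) (B : Mat M) :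
    ∑ i, ((x i - m).ofLp ⬝ᵥ B.mulVec (x i - m).ofLp) =
      (B * sigmaHat x).trace +
        n * ((muHat x - m).ofLp ⬝ᵥ B.mulVec (muHat x - m).ofLp) := by
  simp_rw [← trace_mul_outer, ← Matrix.trace_sum, ← Finset.mul_sum]
  rw [sum_outer_sub hn, Matrix.mul_add, Matrix.trace_add, Matrix.mul_smul, Matrix.trace_smul,
    smul_eq_mul]

lemma sigmaHat_eq_gram (x : Fin n → Vec M) : sigmaHat x = gram fun i => x i - muHat x := rfl

/-! ### The cone of positive definite matrices -/

lemma posDef_congr {V A : Mat M} (hV : V.PosDef) (hA : A.det ≠ 0) :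
    (A * V * A.transpose).PosDef := by
  have hu : IsUnit A := (Matrix.isUnit_iff_isUnit_det A).2 (isUnit_iff_ne_zero.2 hA)
  have := (Matrix.IsUnit.posDef_star_right_conjugate_iff (x := V) hu).2 hV
  rwa [Matrix.star_eq_conjTranspose, Matrix.conjTranspose_eq_transpose_of_trivial] at this

lemma posDef_congr_iff {V A : Mat M} (hA : A.det ≠ 0) :
    (A * V * A.transpose).PosDef ↔ V.PosDef := by
  have hu : IsUnit A := (Matrix.isUnit_iff_isUnit_det A).2 (isUnit_iff_ne_zero.2 hA)
  have := Matrix.IsUnit.posDef_star_right_conjugate_iff (x := V) hu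
  rwa [Matrix.star_eq_conjTranspose, Matrix.conjTranspose_eq_transpose_of_trivial] at this

lemma det_ne_zero_of_mul_transpose {V A : Mat M} (hV : V.PosDef) (h : A * A.transpose = V) :
    A.det ≠ 0 := by
  intro h0
  have := hV.det_pos
  rw [← h, Matrix.det_mul, h0, zero_mul] at this
  exact lt_irrefl _ this

lemma isClosed_posSemidef : IsClosed {V : Mat M | V.PosSemidef} := by
  simp_rw [Matrix.posSemidef_iff_dotProduct_mulVec, Set.ofPred_and, Set.ofPred_forall]
  refine IsClosed.inter (isClosed_eq (by fun_prop) continuous_id)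
    (isClosed_iInter fun x => isClosed_le continuous_const (by fun_prop))

lemma posDef_iff_posSemidef_det {V : Mat M} : V.PosDef ↔ V.PosSemidef ∧ V.det ≠ 0 := by
  constructor
  · exact fun h => ⟨h.posSemidef, h.det_pos.ne'⟩
  · rintro ⟨h, hd⟩
    exact h.posDef_iff_isUnit.2 ((Matrix.isUnit_iff_isUnit_det V).2 (isUnit_iff_ne_zero.2 hd))

lemma measurable_det : Measurable fun V : Mat M => V.det := by
  have : Continuous fun V : Mat M => V.det := by fun_prop
  exact this.measurable

lemma measurable_trace : Measurable fun V : Mat M => V.trace := by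
  have : Continuous fun V : Mat M => V.trace := by fun_prop
  exact this.measurable

lemma measurableSet_posDef : MeasurableSet {V : Mat M | V.PosDef} := by
  simp_rw [posDef_iff_posSemidef_det]
  exact isClosed_posSemidef.measurableSet.inter
    (measurable_det (measurableSet_singleton 0).compl)

lemma measurable_inv_mat : Measurable fun V : Mat M => V⁻¹ := by
  simp_rw [Matrix.inv_def, Ring.inverse_eq_inv']
  have h : Measurable fun V : Mat M => V.adjugate := by
    have : Continuous fun V : Mat M => V.adjugate := by fun_prop
    exact this.measurable
  refine measurable_pi_iff.2 fun i => measurable_pi_iff.2 fun j => ?_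
  exact measurable_det.inv.mul (measurable_pi_iff.1 (measurable_pi_iff.1 h i) j)

lemma measurable_congr (A : Mat M) : Measurable fun V : Mat M => A * V * A.transpose := by
  have : Continuous fun V : Mat M => A * V * A.transpose := by fun_prop
  exact this.measurable

lemma continuous_outer : Continuous fun v : Vec M => outer v := by
  unfold outer
  fun_prop

lemma continuous_gram : Continuous fun Z : Fin k → Vec M => gram Z := by
  unfold gram
  have := continuous_outer (M := M)
  fun_prop

lemma continuous_muHat : Continuous fun x : Fin n → Vec M => muHat x := by
  unfold muHat
  fun_prop

lemma continuous_sigmaHat : Continuous fun x : Fin n → Vec M => sigmaHat x := by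
  unfold sigmaHat
  have := continuous_outer (M := M)
  have := continuous_muHat (M := M) (n := n)
  fun_prop

lemma continuous_mapVecs (A : Mat M) : Continuous fun Z : Fin k → Vec M => mapVecs A Z := by
  unfold mapVecs
  have := (Matrix.toEuclideanLin A).continuous_of_finiteDimensional
  fun_prop

lemma posDef_mul_inv {V : Mat M} (hV : V.PosDef) : V * V⁻¹ = 1 ∧ V⁻¹ * V = 1 :=
  ⟨V.mul_nonsing_inv (isUnit_iff_ne_zero.2 hV.det_pos.ne'),
    V.nonsing_inv_mul (isUnit_iff_ne_zero.2 hV.det_pos.ne')⟩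

lemma sqrt_mul_sqrt {V : Mat M} (hV : V.PosSemidef) : CFC.sqrt V * CFC.sqrt V = V :=
  CFC.sqrt_mul_sqrt_self V hV.nonneg

lemma transpose_sqrt (V : Mat M) : (CFC.sqrt V).transpose = CFC.sqrt V := by
  have h : (CFC.sqrt V).PosSemidef := Matrix.nonneg_iff_posSemidef.1 (CFC.sqrt_nonneg V)
  have := h.isHermitian
  rwa [Matrix.IsHermitian, Matrix.conjTranspose_eq_transpose_of_trivial] at this

/-- Positive definiteness of a scatter matrix is preserved when an observation is added: already
the old observations have at least the scatter `sigmaHat x` about the new mean. -/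
lemma posDef_sigmaHat_extend {x : Fin n → Vec M} (hx : (sigmaHat x).PosDef) (hn : n ≠ 0)
    (y : Vec M) :
    (sigmaHat (extend x y)).PosDef := by
  have h : sigmaHat (extend x y) = sigmaHat x +
      ((n : ℝ) • outer (muHat x - muHat (extend x y)) + outer (y - muHat (extend x y))) := by
    rw [← add_assoc, ← sum_outer_sub hn, sigmaHat, Fin.sum_univ_castSucc]
    simp [extend]
  have ho (v : Vec M) : (outer v).PosSemidef := by
    simpa [outer] using Matrix.posSemidef_vecMulVec_self_star v.ofLp
  rw [h]
  exact hx.add_posSemidef (((ho _).smul (Nat.cast_nonneg n)).add (ho _))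

/-! ### Gaussian densities -/

lemma lintegral_fin_prod_eq_prod {n : ℕ} {E : Type*} [MeasurableSpace E] (μ : Fin n → Measure E)
    [∀ i, SigmaFinite (μ i)] {f : Fin n → E → ENNReal} (hf : ∀ i, Measurable (f i)) :
    ∫⁻ x, ∏ i, f i (x i) ∂(Measure.pi μ) = ∏ i, ∫⁻ x, f i x ∂(μ i) := by
  induction n with
  | zero => simp
  | succ n ih =>
    rw [← ((measurePreserving_piFinSuccAbove μ 0).symm).lintegral_comp_emb
      (MeasurableEquiv.measurableEmbedding _)]
    simp_rw [MeasurableEquiv.piFinSuccAbove_symm_apply, Fin.insertNthEquiv,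
      Fin.prod_univ_succ, Fin.insertNth_zero, Equiv.coe_fn_mk, Fin.cons_succ,
      Fin.zero_succAbove, cast_eq, Fin.cons_zero]
    rw [← ih (fun i => μ i.succ) (fun i => hf i.succ)]
    exact lintegral_prod_mul (μ := μ 0) (ν := Measure.pi fun i => μ i.succ) (f := f 0)
      (g := fun x => ∏ i : Fin n, f i.succ (x i)) (hf 0).aemeasurable
      (Finset.measurable_prod _ fun i _ =>
        (hf i.succ).comp (measurable_pi_apply i)).aemeasurable

lemma pi_withDensity_fin {n : ℕ} {E : Type*} [MeasurableSpace E] (μ : Fin n → Measure E)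
    [∀ i, SigmaFinite (μ i)] {f : Fin n → E → ENNReal} (hf : ∀ i, Measurable (f i))
    [∀ i, SigmaFinite ((μ i).withDensity (f i))] :
    Measure.pi (fun i => (μ i).withDensity (f i)) =
      (Measure.pi μ).withDensity fun x => ∏ i, f i (x i) := by
  refine Measure.pi_eq fun s hs => ?_
  rw [withDensity_apply _ (MeasurableSet.univ_pi hs), Measure.restrict_pi_pi,
    lintegral_fin_prod_eq_prod _ hf]
  exact Finset.prod_congr rfl fun i _ => (withDensity_apply _ (hs i)).symm

lemma det_toEuclideanLin (A : Mat M) : LinearMap.det (Matrix.toEuclideanLin A) = A.det := by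
  rw [Matrix.toEuclideanLin, Matrix.toLpLin_eq_toLin, LinearMap.det_toLin]

/-- The map `A ↦ (A z₁, …, A z_k)` as a linear map. -/
def mapVecsLin (A : Mat M) : (Fin k → Vec M) →ₗ[ℝ] (Fin k → Vec M) :=
  LinearMap.pi fun i => Matrix.toEuclideanLin A ∘ₗ LinearMap.proj i

lemma lintegral_mapVecs {A : Mat M} (hA : A.det ≠ 0) {f : (Fin k → Vec M) → ENNReal}
    (hf : Measurable f) :
    ∫⁻ Z, f (mapVecs A Z) = ENNReal.ofReal ((|A.det| ^ k)⁻¹) * ∫⁻ Z, f Z := by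
  have hd : LinearMap.det (mapVecsLin (k := k) A) = A.det ^ k := by
    rw [mapVecsLin, LinearMap.det_pi]
    simp
  have h := Measure.map_linearMap_addHaar_eq_smul_addHaar
    (volume : Measure (Fin k → Vec M)) (f := mapVecsLin A) (by rw [hd]; exact pow_ne_zero _ hA)
  have h2 : ∫⁻ Z, f (mapVecs A Z) = ∫⁻ Z, f Z ∂(volume.map (mapVecsLin A)) := by
    rw [lintegral_map hf]
    · rfl
    · exact (continuous_mapVecs A).measurable
  rw [h2, h, lintegral_smul_measure, hd, abs_inv, abs_pow, smul_eq_mul]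

lemma lintegral_toEuclideanLin {A : Mat M} (hA : A.det ≠ 0) {f : Vec M → ENNReal}
    (hf : Measurable f) :
    ∫⁻ z, f (Matrix.toEuclideanLin A z) = ENNReal.ofReal (|A.det|⁻¹) * ∫⁻ z, f z := by
  have h := Measure.map_linearMap_addHaar_eq_smul_addHaar
    (volume : Measure (Vec M)) (f := Matrix.toEuclideanLin A) (by rwa [det_toEuclideanLin])
  have hm := (Matrix.toEuclideanLin A).continuous_of_finiteDimensional.measurable
  rw [← lintegral_map hf hm, h, lintegral_smul_measure, det_toEuclideanLin, abs_inv, smul_eq_mul]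

lemma gaussDensity_nonneg (m : Vec M) (S : Mat M) (y : Vec M) : 0 ≤ gaussDensity m S y := by
  unfold gaussDensity
  positivity

lemma measurable_quadForm {X : Type*} [MeasurableSpace X] {v : X → Vec M} {A : X → Mat M}
    (hv : Measurable v) (hA : Measurable A) :
    Measurable fun x => (v x).ofLp ⬝ᵥ (A x).mulVec (v x).ofLp := by
  have h : ∀ i, Measurable fun x => (v x).ofLp i := fun i => by fun_prop
  have h' : ∀ i j, Measurable fun x => A x i j := fun i j =>
    measurable_pi_iff.1 (measurable_pi_iff.1 hA i) j
  simp only [dotProduct, Matrix.mulVec]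
  fun_prop

lemma measurable_gaussDensity {X : Type*} [MeasurableSpace X] {m y : X → Vec M} {S : X → Mat M}
    (hm : Measurable m) (hS : Measurable S) (hy : Measurable y) :
    Measurable fun x => gaussDensity (m x) (S x) (y x) := by
  unfold gaussDensity
  have h1 := measurable_det.comp hS
  have h2 := measurable_quadForm (hy.sub hm) (measurable_inv_mat.comp hS)
  simp only [Function.comp_def] at h1 h2
  exact ((measurable_const.mul h1).sqrt.const_div 1).mul (h2.const_mul _).exp

lemma measurable_likelihood {X : Type*} [MeasurableSpace X] {x : X → Fin n → Vec M} {m : X → Vec M}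
    {S : X → Mat M} (hx : Measurable x) (hm : Measurable m) (hS : Measurable S) :
    Measurable fun a => likelihood (x a) (m a) (S a) := by
  unfold likelihood
  exact Finset.measurable_prod _ fun i _ =>
    measurable_gaussDensity hm hS ((measurable_pi_apply i).comp hx)

lemma gaussDensity_zero_one (z : Vec M) :
    gaussDensity 0 1 z = (√((2 * Real.pi) ^ M))⁻¹ * Real.exp (-(‖z‖ ^ 2 / 2)) := by
  rw [gaussDensity, EuclideanSpace.real_norm_sq_eq]
  simp only [Matrix.det_one, mul_one, one_div, sub_zero, inv_one, Matrix.one_mulVec]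
  congr 2
  simp only [dotProduct, ← pow_two]
  ring

theorem stdGaussian_eq_withDensity :
    stdGaussian (Vec M) = volume.withDensity fun z => ENNReal.ofReal (gaussDensity 0 1 z) := by
  have h1 : Measure.pi (fun _ : Fin M => gaussianReal 0 1) =
      volume.withDensity fun x : Fin M → ℝ => ∏ i, gaussianPDF 0 1 (x i) := by
    have h : ∀ i : Fin M, gaussianReal 0 1 = volume.withDensity (gaussianPDF 0 1) :=
      fun _ => gaussianReal_of_var_ne_zero 0 one_ne_zero
    have : SigmaFinite ((volume : Measure ℝ).withDensity (gaussianPDF 0 1)) := by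
      rw [← gaussianReal_of_var_ne_zero 0 one_ne_zero]
      infer_instance
    simp_rw [gaussianReal_of_var_ne_zero 0 (one_ne_zero (α := NNReal))]
    rw [pi_withDensity_fin _ fun _ => measurable_gaussianPDF 0 1]
    rfl
  have hg : Measurable fun z : Vec M => ENNReal.ofReal (gaussDensity 0 1 z) :=
    (measurable_gaussDensity measurable_const measurable_const measurable_id).ennreal_ofReal
  have hmp := (EuclideanSpace.volume_preserving_symm_measurableEquiv_toLp (Fin M)).symm
  rw [← map_pi_eq_stdGaussian, h1]
  refine Measure.ext_of_lintegral _ fun f hf => ?_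
  have hgm : Measurable fun x : Fin M → ℝ => ∏ i, gaussianPDF 0 1 (x i) :=
    Finset.measurable_prod _ fun i _ => (measurable_gaussianPDF 0 1).comp (measurable_pi_apply i)
  rw [lintegral_map hf (by fun_prop), lintegral_withDensity_eq_lintegral_mul _ hgm (by fun_prop),
    lintegral_withDensity_eq_lintegral_mul _ hg hf, ← hmp.lintegral_comp (hg.mul hf)]
  refine lintegral_congr fun x => ?_
  simp only [Pi.mul_apply, MeasurableEquiv.symm_symm, MeasurableEquiv.toLp_apply]
  congr 1
  simp only [gaussianPDF, gaussianPDFReal]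
  rw [← ENNReal.ofReal_prod_of_nonneg fun i _ => by positivity, Finset.prod_mul_distrib,
    ← Real.exp_sum, gaussDensity_zero_one, EuclideanSpace.real_norm_sq_eq]
  congr 2
  · simp [Real.sqrt_eq_rpow, ← Real.rpow_natCast, ← Real.rpow_mul, Real.pi_pos.le]
    rw [mul_comm (2⁻¹ : ℝ)]
  · simp [Finset.sum_div, neg_div]

lemma gaussDensity_affine {A : Mat M} (hA : A.det ≠ 0) (m z : Vec M) :
    gaussDensity 0 1 z =
      |A.det| * gaussDensity m (A * A.transpose) (m + Matrix.toEuclideanLin A z) := by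
  have hu : IsUnit A.det := isUnit_iff_ne_zero.2 hA
  have h1 : (Matrix.toEuclideanLin A z).ofLp = A.mulVec z.ofLp := by simp [Matrix.toLpLin_apply]
  have h2 : A.mulVec z.ofLp ⬝ᵥ (A * A.transpose)⁻¹.mulVec (A.mulVec z.ofLp) =
      z.ofLp ⬝ᵥ z.ofLp := by
    rw [Matrix.mul_inv_rev, Matrix.mulVec_mulVec, Matrix.mul_assoc, Matrix.nonsing_inv_mul _ hu,
      Matrix.mul_one, Matrix.dotProduct_mulVec, ← Matrix.mulVec_transpose, Matrix.mulVec_mulVec,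
      Matrix.transpose_nonsing_inv, Matrix.transpose_transpose, Matrix.nonsing_inv_mul _ hu,
      Matrix.one_mulVec]
  simp only [gaussDensity, add_sub_cancel_left, h1, h2, Matrix.det_mul, Matrix.det_transpose,
    Matrix.det_one, mul_one, sub_zero, inv_one, Matrix.one_mulVec]
  rw [← pow_two, Real.sqrt_mul (by positivity), Real.sqrt_sq_eq_abs]
  have : |A.det| ≠ 0 := abs_ne_zero.2 hA
  field_simp

theorem map_affine_stdGaussian {A : Mat M} (hA : A.det ≠ 0) (m : Vec M) :
    (stdGaussian (Vec M)).map (fun z => m + Matrix.toEuclideanLin A z) =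
      volume.withDensity fun y => ENNReal.ofReal (gaussDensity m (A * A.transpose) y) := by
  have hg : Measurable fun z : Vec M => ENNReal.ofReal (gaussDensity m (A * A.transpose) z) :=
    (measurable_gaussDensity measurable_const measurable_const measurable_id).ennreal_ofReal
  have hg0 : Measurable fun z : Vec M => ENNReal.ofReal (gaussDensity 0 1 z) :=
    (measurable_gaussDensity measurable_const measurable_const measurable_id).ennreal_ofReal
  have hm : Measurable fun z => Matrix.toEuclideanLin A z :=
    (Matrix.toEuclideanLin A).continuous_of_finiteDimensional.measurable
  refine Measure.ext_of_lintegral _ fun f hf => ?_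
  have hG : Measurable fun y => ENNReal.ofReal (gaussDensity m (A * A.transpose) (m + y)) *
      f (m + y) := (hg.mul hf).comp (measurable_const_add m)
  rw [lintegral_map hf (by fun_prop), stdGaussian_eq_withDensity,
    lintegral_withDensity_eq_lintegral_mul _ hg0 (by fun_prop),
    lintegral_withDensity_eq_lintegral_mul _ hg hf]
  simp only [Pi.mul_apply]
  rw [← lintegral_add_left_eq_self (fun y => ENNReal.ofReal
    (gaussDensity m (A * A.transpose) y) * f y) m]
  calc _ = ENNReal.ofReal |A.det| * ∫⁻ z, ENNReal.ofReal (gaussDensity m (A * A.transpose)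
        (m + Matrix.toEuclideanLin A z)) * f (m + Matrix.toEuclideanLin A z) := by
        have hG' : Measurable fun z => ENNReal.ofReal (gaussDensity m (A * A.transpose)
            (m + Matrix.toEuclideanLin A z)) * f (m + Matrix.toEuclideanLin A z) := hG.comp hm
        rw [← lintegral_const_mul _ hG']
        refine lintegral_congr fun z => ?_
        rw [gaussDensity_affine hA m z, ENNReal.ofReal_mul (abs_nonneg _), mul_assoc]
    _ = _ := by
        rw [lintegral_toEuclideanLin hA hG, ← mul_assoc, ← ENNReal.ofReal_mul (abs_nonneg _),
          mul_inv_cancel₀ (abs_ne_zero.2 hA), ENNReal.ofReal_one, one_mul]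

theorem multivariateGaussian_eq_withDensity {S : Mat M} (hS : S.PosDef) (m : Vec M) :
    multivariateGaussian m S =
      volume.withDensity fun y => ENNReal.ofReal (gaussDensity m S y) := by
  have h := sqrt_mul_sqrt hS.posSemidef
  have hd : (CFC.sqrt S).det ≠ 0 := by
    intro h0
    have := hS.det_pos
    rw [← h, Matrix.det_mul, h0, zero_mul] at this
    exact lt_irrefl _ this
  have := map_affine_stdGaussian hd m
  rw [transpose_sqrt, h] at this
  rw [← this]
  rfl

theorem map_stdGaussian_eq_multivariateGaussian {S A : Mat M} (hS : S.PosDef)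
    (hA : A * A.transpose = S) (m : Vec M) :
    (stdGaussian (Vec M)).map (fun z => m + Matrix.toEuclideanLin A z) =
      multivariateGaussian m S := by
  rw [map_affine_stdGaussian (det_ne_zero_of_mul_transpose hS hA), hA,
    multivariateGaussian_eq_withDensity hS]

lemma lintegral_gaussDensity {S : Mat M} (hS : S.PosDef) (m : Vec M) :
    ∫⁻ y, ENNReal.ofReal (gaussDensity m S y) = 1 := by
  have h : multivariateGaussian m S Set.univ = 1 := measure_univ
  rwa [multivariateGaussian_eq_withDensity hS, withDensity_apply _ MeasurableSet.univ,
    Measure.restrict_univ] at h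

theorem sampleLaw_eq_withDensity {S : Mat M} (hS : S.PosDef) (m : Vec M) :
    sampleLaw M n m S = (volume : Measure (Fin n → Vec M)).withDensity
      fun x => ENNReal.ofReal (likelihood x m S) := by
  have : SigmaFinite ((volume : Measure (Vec M)).withDensity
      fun y => ENNReal.ofReal (gaussDensity m S y)) := by
    rw [← multivariateGaussian_eq_withDensity hS]
    infer_instance
  have hg : Measurable fun y : Vec M => ENNReal.ofReal (gaussDensity m S y) :=
    (measurable_gaussDensity measurable_const measurable_const measurable_id).ennreal_ofReal
  rw [sampleLaw, multivariateGaussian_eq_withDensity hS, pi_withDensity_fin _ fun _ => hg]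
  congr 1
  ext x
  rw [likelihood, ENNReal.ofReal_prod_of_nonneg fun i _ => gaussDensity_nonneg _ _ _]

lemma likelihood_zero_one (Z : Fin k → Vec M) :
    likelihood Z 0 1 = (√((2 * Real.pi) ^ M) ^ k)⁻¹ * Real.exp (-((gram Z).trace / 2)) := by
  simp only [likelihood, gaussDensity_zero_one]
  rw [Finset.prod_mul_distrib, ← Real.exp_sum, trace_gram]
  simp [Finset.sum_div]

lemma sampleLaw_zero_one :
    sampleLaw M n 0 1 = Measure.pi fun _ : Fin n => stdGaussian (Vec M) := by
  rw [sampleLaw, multivariateGaussian_zero_one]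

lemma pi_stdGaussian_eq_withDensity :
    Measure.pi (fun _ : Fin k => stdGaussian (Vec M)) =
      (volume : Measure (Fin k → Vec M)).withDensity fun Z => ENNReal.ofReal
        ((√((2 * Real.pi) ^ M) ^ k)⁻¹ * Real.exp (-((gram Z).trace / 2))) := by
  rw [← sampleLaw_zero_one, sampleLaw_eq_withDensity Matrix.PosDef.one]
  simp_rw [likelihood_zero_one]

/-! ### The Jacobian of congruence on symmetric matrices -/

/-- The entries of a matrix on and above the diagonal. -/
def upperPart (V : Mat M) (p : {p : Fin M × Fin M // p.1 ≤ p.2}) : ℝ := V p.1.1 p.1.2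

lemma upperPart_symOfUpper (v : {p : Fin M × Fin M // p.1 ≤ p.2} → ℝ) :
    upperPart (symOfUpper v) = v := by
  ext ⟨⟨i, j⟩, h⟩
  have h : i ≤ j := h
  simp [upperPart, symOfUpper, min_eq_left h, max_eq_right h]

lemma symOfUpper_upperPart {V : Mat M} (hV : V.transpose = V) : symOfUpper (upperPart V) = V := by
  ext i j
  rcases le_total i j with h | h
  · simp [upperPart, symOfUpper, min_eq_left h, max_eq_right h]
  · simp only [upperPart, symOfUpper, Matrix.of_apply, min_eq_right h, max_eq_left h]
    exact congrFun (congrFun hV i) j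

lemma transpose_symOfUpper (v : {p : Fin M × Fin M // p.1 ≤ p.2} → ℝ) :
    (symOfUpper v).transpose = symOfUpper v := by
  ext i j
  simp [symOfUpper, min_comm, max_comm]

lemma continuous_symOfUpper : Continuous (symOfUpper (M := M)) := by
  unfold symOfUpper
  refine continuous_matrix fun i j => ?_
  simp only [Matrix.of_apply]
  fun_prop

lemma measurable_upperPart : Measurable (upperPart (M := M)) :=
  measurable_pi_iff.2 fun p =>
    (measurable_pi_apply p.1.2).comp (measurable_pi_apply (X := fun _ => Fin M → ℝ) p.1.1)

/-- The map `V ↦ A V Aᵀ` on symmetric matrices, in the coordinates given by the upper triangle. -/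
def congrLin (A : Mat M) : ({p : Fin M × Fin M // p.1 ≤ p.2} → ℝ) →ₗ[ℝ]
    ({p : Fin M × Fin M // p.1 ≤ p.2} → ℝ) where
  toFun v := upperPart (A * symOfUpper v * A.transpose)
  map_add' v w := by
    have : symOfUpper (v + w) = symOfUpper v + symOfUpper w := by ext; simp [symOfUpper]
    ext p
    simp [this, Matrix.mul_add, Matrix.add_mul, upperPart]
  map_smul' c v := by
    have : symOfUpper (c • v) = c • symOfUpper v := by ext; simp [symOfUpper]
    ext p
    simp [this, upperPart]

lemma congrLin_apply (A : Mat M) (v : {p : Fin M × Fin M // p.1 ≤ p.2} → ℝ) :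
    congrLin A v = upperPart (A * symOfUpper v * A.transpose) := rfl

lemma symOfUpper_congrLin (A : Mat M) (v : {p : Fin M × Fin M // p.1 ≤ p.2} → ℝ) :
    symOfUpper (congrLin A v) = A * symOfUpper v * A.transpose := by
  rw [congrLin_apply, symOfUpper_upperPart]
  simp [Matrix.transpose_mul, transpose_symOfUpper, Matrix.mul_assoc]

lemma congrLin_mul (A B : Mat M) : congrLin (A * B) = congrLin A ∘ₗ congrLin B := by
  ext1 p
  refine LinearMap.ext fun c => ?_
  simp only [LinearMap.comp_apply]
  generalize LinearMap.single ℝ (fun _ => ℝ) p c = v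
  rw [congrLin_apply, congrLin_apply A, symOfUpper_congrLin, Matrix.transpose_mul]
  simp only [Matrix.mul_assoc]

lemma det_congrLin_mul (A B : Mat M) :
    LinearMap.det (congrLin (A * B)) = LinearMap.det (congrLin A) * LinearMap.det (congrLin B) := by
  rw [congrLin_mul, LinearMap.det_comp]

lemma det_congrLin_one : LinearMap.det (congrLin (1 : Mat M)) = 1 := by
  have : congrLin (1 : Mat M) = LinearMap.id := by
    refine LinearMap.ext fun v => ?_
    simp [congrLin_apply, upperPart_symOfUpper]
  rw [this, LinearMap.det_id]

/-- The index `i` occurs in `M - i` pairs as the first and in `i + 1` pairs as the second entry. -/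
lemma prod_upper_mul (D : Fin M → ℝ) :
    ∏ p : {p : Fin M × Fin M // p.1 ≤ p.2}, (D p.1.1 * D p.1.2) = (∏ i, D i) ^ (M + 1) := by
  rw [← Finset.prod_subtype (Finset.univ.filter fun p : Fin M × Fin M => p.1 ≤ p.2) (by simp)
    (fun p => D p.1 * D p.2), Finset.prod_filter, Fintype.prod_prod_type]
  have h : ∀ i j : Fin M, (if i ≤ j then D i * D j else 1) =
      (if i ≤ j then D i else 1) * (if i ≤ j then D j else 1) := by
    intro i j; split_ifs <;> simp
  simp_rw [h, Finset.prod_mul_distrib]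
  rw [Finset.prod_comm (f := fun i j => if i ≤ j then D j else 1), ← Finset.prod_mul_distrib,
    ← Finset.prod_pow]
  refine Finset.prod_congr rfl fun i _ => ?_
  rw [Finset.prod_ite, Finset.prod_ite]
  simp only [Finset.prod_const, one_pow, mul_one]
  rw [Finset.filter_le_eq_Ici, Finset.filter_ge_eq_Iic, Fin.card_Ici, Fin.card_Iic, ← pow_add]
  congr 1
  omega

lemma det_congrLin_diagonal (D : Fin M → ℝ) :
    LinearMap.det (congrLin (Matrix.diagonal D)) = (Matrix.diagonal D).det ^ (M + 1) := by
  have : congrLin (Matrix.diagonal D) = LinearMap.pi fun p =>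
      ((D p.1.1 * D p.1.2) • LinearMap.id) ∘ₗ LinearMap.proj p := by
    refine LinearMap.ext fun v => ?_
    ext ⟨⟨i, j⟩, h⟩
    have h : i ≤ j := h
    simp [congrLin, upperPart, symOfUpper, Matrix.diagonal_transpose, min_eq_left h,
      max_eq_right h]
    ring
  rw [this, LinearMap.det_pi, Matrix.det_diagonal, ← prod_upper_mul]
  simp

/-- Congruence by a transvection preserves volume: a transvection is conjugate to its square by
a diagonal matrix, so that its determinant equals its own square. -/
lemma det_congrLin_transvection {i j : Fin M} (hij : i ≠ j) (c : ℝ) :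
    LinearMap.det (congrLin (Matrix.transvection i j c)) = 1 := by
  set D : Fin M → ℝ := Function.update 1 i 2 with hD
  have h1 : Matrix.diagonal D * Matrix.transvection i j c =
      Matrix.transvection i j c * Matrix.transvection i j c * Matrix.diagonal D := by
    rw [Matrix.transvection_mul_transvection_same _ _ hij]
    ext a b
    rw [Matrix.diagonal_mul, Matrix.mul_diagonal]
    simp only [Matrix.transvection, Matrix.add_apply, Matrix.one_apply, Matrix.single_apply, hD,
      Function.update_apply, Pi.one_apply]
    by_cases ha : a = i <;> by_cases hb : b = j <;> by_cases hab : a = b <;> grind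
  have hDne : LinearMap.det (congrLin (Matrix.diagonal D)) ≠ 0 := by
    rw [det_congrLin_diagonal, Matrix.det_diagonal]
    refine pow_ne_zero _ (Finset.prod_ne_zero_iff.2 fun a _ => ?_)
    rw [hD, Function.update_apply]
    split_ifs <;> simp
  have hinv : Matrix.transvection i j c * Matrix.transvection i j (-c) = 1 := by
    rw [Matrix.transvection_mul_transvection_same _ _ hij]
    simp
  have hT : LinearMap.det (congrLin (Matrix.transvection i j c)) ≠ 0 := by
    intro h0
    have := congrArg (fun A : Mat M => LinearMap.det (congrLin A)) hinv
    simp only [det_congrLin_mul, h0, zero_mul, det_congrLin_one] at this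
    exact zero_ne_one this
  have := congrArg (fun A : Mat M => LinearMap.det (congrLin A)) h1
  simp only [det_congrLin_mul] at this
  have h2 := mul_right_cancel₀ hDne ((mul_comm _ _).trans this)
  exact (mul_left_cancel₀ hT ((mul_one _).trans h2)).symm

theorem det_congrLin {A : Mat M} (hA : A.det ≠ 0) :
    LinearMap.det (congrLin A) = A.det ^ (M + 1) := by
  refine Matrix.diagonal_transvection_induction_of_det_ne_zero
    (fun A : Mat M => LinearMap.det (congrLin A) = A.det ^ (M + 1)) A hA
    (fun D _ => det_congrLin_diagonal D) (fun t => ?_) (fun A B _ _ h1 h2 => ?_)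
  · rw [Matrix.TransvectionStruct.toMatrix, det_congrLin_transvection t.hij,
      Matrix.det_transvection_of_ne _ _ t.hij, one_pow]
  · rw [det_congrLin_mul, h1, h2, Matrix.det_mul, mul_pow]

lemma lintegral_congr_symLebesgue {A : Mat M} (hA : A.det ≠ 0) {f : Mat M → ENNReal}
    (hf : Measurable f) :
    ∫⁻ V, f V ∂(symLebesgue M) = ENNReal.ofReal (|A.det| ^ (M + 1)) *
      ∫⁻ V, f (A * V * A.transpose) ∂(symLebesgue M) := by
  have hs := (continuous_symOfUpper (M := M)).measurable
  have hd := det_congrLin hA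
  have hne : LinearMap.det (congrLin A) ≠ 0 := by rw [hd]; exact pow_ne_zero _ hA
  have hm : Measurable (congrLin A) := (congrLin A).continuous_of_finiteDimensional.measurable
  have h := Real.map_linearMap_volume_pi_eq_smul_volume_pi hne
  rw [symLebesgue, lintegral_map hf hs,
    lintegral_map (f := fun V => f (A * V * A.transpose)) (hf.comp (measurable_congr A)) hs]
  simp_rw [← symOfUpper_congrLin]
  rw [← lintegral_map (f := fun v => f (symOfUpper v)) (hf.comp hs) hm, h,
    lintegral_smul_measure, hd, abs_inv, abs_pow, smul_eq_mul,
    ← mul_assoc, ← ENNReal.ofReal_mul (by positivity), mul_inv_cancel₀ (by positivity),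
    ENNReal.ofReal_one, one_mul]

theorem lintegral_congr_posDefLebesgue {A : Mat M} (hA : A.det ≠ 0) {f : Mat M → ENNReal}
    (hf : Measurable f) :
    ∫⁻ V, f V ∂(posDefLebesgue M) = ENNReal.ofReal (|A.det| ^ (M + 1)) *
      ∫⁻ V, f (A * V * A.transpose) ∂(posDefLebesgue M) := by
  have hP := measurableSet_posDef (M := M)
  rw [posDefLebesgue, ← lintegral_indicator hP, ← lintegral_indicator hP,
    lintegral_congr_symLebesgue hA (hf.indicator hP)]
  congr 1
  refine lintegral_congr fun V => ?_
  by_cases hV : V.PosDef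
  · rw [Set.indicator_of_mem (show V ∈ {V : Mat M | V.PosDef} from hV), Set.indicator_of_mem]
    exact posDef_congr hV hA
  · rw [Set.indicator_of_notMem (show V ∉ {V : Mat M | V.PosDef} from hV),
      Set.indicator_of_notMem]
    exact fun h => hV ((posDef_congr_iff hA).1 h)

lemma ae_posDef_posDefLebesgue : ∀ᵐ V ∂(posDefLebesgue M), V.PosDef :=
  ae_restrict_mem measurableSet_posDef

/-- A symmetric matrix close to the identity is positive definite: by the Cauchy–Schwarz inequality
the perturbation changes the quadratic form by less than `∑ xᵢ²`. -/
lemma posDef_of_near_one {V : Mat M} (hV : V.transpose = V)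
    (h : ∀ i j, |V i j - (1 : Mat M) i j| ≤ (2 * ((M : ℝ) + 1))⁻¹) : V.PosDef := by
  refine Matrix.PosDef.of_dotProduct_mulVec_pos ?_ fun x hx => ?_
  · rwa [Matrix.IsHermitian, Matrix.conjTranspose_eq_transpose_of_trivial]
  · have hx2 : 0 < ∑ i, x i ^ 2 := by
      obtain ⟨i, hi⟩ := Function.ne_iff.1 hx
      exact Finset.sum_pos' (fun i _ => sq_nonneg _) ⟨i, Finset.mem_univ _, by
        have : x i ≠ 0 := hi
        positivity⟩
    have hcs : (∑ i, |x i|) ^ 2 ≤ M * ∑ i, x i ^ 2 := by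
      simpa using sq_sum_le_card_mul_sum_sq (s := Finset.univ) (f := fun i => |x i|)
    have he : star x ⬝ᵥ V.mulVec x = ∑ i, x i ^ 2 +
        ∑ i, ∑ j, (V i j - (1 : Mat M) i j) * (x i * x j) := by
      simp only [sub_mul, Finset.sum_sub_distrib]
      simp only [Matrix.one_apply, ite_mul, one_mul, zero_mul, Finset.sum_ite_eq, Finset.mem_univ,
        if_true, dotProduct, Matrix.mulVec, Finset.mul_sum, Pi.star_apply, star_trivial]
      simp only [← pow_two, add_sub_cancel]
      exact Finset.sum_congr rfl fun i _ => Finset.sum_congr rfl fun j _ => by ring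
    have hb : |∑ i, ∑ j, (V i j - (1 : Mat M) i j) * (x i * x j)| ≤
        (2 * ((M : ℝ) + 1))⁻¹ * (∑ i, |x i|) ^ 2 := by
      rw [pow_two, Finset.sum_mul_sum, Finset.mul_sum]
      refine (Finset.abs_sum_le_sum_abs _ _).trans (Finset.sum_le_sum fun i _ => ?_)
      rw [Finset.mul_sum]
      refine (Finset.abs_sum_le_sum_abs _ _).trans (Finset.sum_le_sum fun j _ => ?_)
      rw [abs_mul, abs_mul]
      exact mul_le_mul_of_nonneg_right (h i j) (by positivity)
    have hc : (2 * ((M : ℝ) + 1))⁻¹ * (∑ i, |x i|) ^ 2 < ∑ i, x i ^ 2 := by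
      rw [inv_mul_lt_iff₀ (by positivity)]
      have : (0 : ℝ) ≤ M := Nat.cast_nonneg M
      nlinarith
    rw [he]
    linarith [neg_abs_le (∑ i, ∑ j, (V i j - (1 : Mat M) i j) * (x i * x j))]

lemma posDefLebesgue_ne_zero : posDefLebesgue M ≠ 0 := by
  intro h0
  have h1 : posDefLebesgue M Set.univ = 0 := by simp [h0]
  rw [posDefLebesgue, Measure.restrict_apply_univ, symLebesgue,
    Measure.map_apply continuous_symOfUpper.measurable measurableSet_posDef] at h1
  have h2 : Metric.ball (upperPart (1 : Mat M)) (2 * ((M : ℝ) + 1))⁻¹ ⊆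
      symOfUpper ⁻¹' {V : Mat M | V.PosDef} := by
    intro v hv
    have hv' : ∀ p, |v p - upperPart 1 p| < (2 * ((M : ℝ) + 1))⁻¹ := by
      have := (dist_pi_lt_iff (by positivity)).1 (Metric.mem_ball.1 hv)
      simpa [Real.dist_eq] using this
    refine posDef_of_near_one (transpose_symOfUpper v) fun i j => ?_
    have h3 : (1 : Mat M) i j = symOfUpper (upperPart (1 : Mat M)) i j := by
      rw [symOfUpper_upperPart Matrix.transpose_one]
    rw [h3]
    simpa [symOfUpper] using (hv' ⟨(min i j, max i j), min_le_max⟩).le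
  have h3 := measure_mono_null h2 h1
  exact (Metric.measure_ball_pos volume _ (by positivity)).ne' h3

/-! ### Generic position of vectors -/

lemma continuous_rowMat : Continuous fun Z : Fin k → Vec M => rowMat Z := by
  refine continuous_matrix fun i j => ?_
  simp only [rowMat, Matrix.of_apply]
  fun_prop

/-- Almost all families of `k ≥ M` vectors in `ℝ^M` have linearly independent first `M` members:
on each line in the direction of a family starting with the standard basis, the determinant is a
monic polynomial in the parameter. -/
lemma ae_det_ne_zero (h : M ≤ k) :
    ∀ᵐ Z ∂(volume : Measure (Fin k → Vec M)),
      ((rowMat Z).submatrix (Fin.castLE h) id).det ≠ 0 := by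
  set D : (Fin k → Vec M) → ℝ := fun Z => ((rowMat Z).submatrix (Fin.castLE h) id).det with hD
  have hDc : Continuous D := by
    have := continuous_rowMat (M := M) (k := k)
    fun_prop
  set E : Fin k → Vec M := fun i => WithLp.toLp 2 fun j => if (i : ℕ) = j then 1 else 0 with hE
  have hDt (Z : Fin k → Vec M) (t : ℝ) :
      D (t • E + Z) = (-(rowMat Z).submatrix (Fin.castLE h) id).charpoly.eval t := by
    rw [Matrix.eval_charpoly, hD]
    refine congrArg Matrix.det ?_
    ext i j
    simp [rowMat, hE, Matrix.diagonal_apply, Fin.ext_iff]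
  have hfin (Z : Fin k → Vec M) : (volume : Measure ℝ) {t | D (t • E + Z) = 0} = 0 := by
    refine Set.Finite.measure_zero ?_ _
    simp_rw [hDt]
    exact Polynomial.finite_setOfPred_isRoot (Matrix.charpoly_monic _).ne_zero
  have hN : MeasurableSet {Z | D Z = 0} := (isClosed_eq hDc continuous_const).measurableSet
  set F : (Fin k → Vec M) → ENNReal := {Z | D Z = 0}.indicator 1 with hF
  have hFm : Measurable F := measurable_one.indicator hN
  have h1 : ∫⁻ t in Set.Icc (0 : ℝ) 1, ∫⁻ Z, F (t • E + Z) = ∫⁻ Z, F Z := by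
    simp_rw [lintegral_add_left_eq_self F]
    simp
  have h2 : ∫⁻ t in Set.Icc (0 : ℝ) 1, ∫⁻ Z, F (t • E + Z) = 0 := by
    rw [lintegral_lintegral_swap]
    · refine (lintegral_congr fun Z => ?_).trans lintegral_zero
      have : (fun t => F (t • E + Z)) = {t : ℝ | D (t • E + Z) = 0}.indicator 1 := rfl
      have hms : MeasurableSet {t : ℝ | D (t • E + Z) = 0} :=
        (isClosed_eq (by fun_prop) continuous_const).measurableSet
      rw [this, lintegral_indicator_one hms]
      exact Measure.restrict_le_self.absolutelyContinuous (hfin Z)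
    · exact (hFm.comp (by fun_prop)).aemeasurable
  rw [ae_iff]
  rw [h2, hF, lintegral_indicator_one hN] at h1
  simpa using h1.symm

lemma posDef_gram_of_det_ne_zero (h : M ≤ k) {Z : Fin k → Vec M}
    (hZ : ((rowMat Z).submatrix (Fin.castLE h) id).det ≠ 0) : (gram Z).PosDef := by
  rw [gram_eq_transpose_mul, ← Matrix.conjTranspose_eq_transpose_of_trivial]
  refine Matrix.PosDef.conjTranspose_mul_self _ fun v w hvw => ?_
  have hu := (Matrix.isUnit_iff_isUnit_det _).2 (isUnit_iff_ne_zero.2 hZ)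
  refine Matrix.mulVec_injective_of_isUnit hu ?_
  ext i
  exact congrFun hvw (Fin.castLE h i)

lemma ae_posDef_gram (h : M ≤ k) :
    ∀ᵐ Z ∂(volume : Measure (Fin k → Vec M)), (gram Z).PosDef := by
  filter_upwards [ae_det_ne_zero h] with Z hZ using posDef_gram_of_det_ne_zero h hZ

lemma ae_det_rowMat_ne_zero :
    ∀ᵐ A ∂(volume : Measure (Fin M → Vec M)), (rowMat A).det ≠ 0 :=
  ae_det_ne_zero le_rfl

/-! ### Uniqueness of the invariant measure on the cone -/

/-- Haar measure on the invertible matrices, a matrix being given by its rows. -/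
def haarGL (M : ℕ) : Measure (Fin M → Vec M) :=
  volume.withDensity fun A => ENNReal.ofReal (|(rowMat A).det| ^ M)⁻¹

lemma measurable_haarGL_density :
    Measurable fun A : Fin M → Vec M => ENNReal.ofReal (|(rowMat A).det| ^ M)⁻¹ := by
  have h := (measurable_det (M := M)).comp (continuous_rowMat (M := M) (k := M)).measurable
  simp only [Function.comp_def] at h
  fun_prop

instance instSFiniteHaarGL : SFinite (haarGL M) := by
  unfold haarGL
  infer_instance

lemma ae_haarGL_det_ne_zero : ∀ᵐ A ∂(haarGL M), (rowMat A).det ≠ 0 :=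
  (withDensity_absolutelyContinuous _ _).ae_le ae_det_rowMat_ne_zero

/-- Haar measure is invariant under right multiplication. -/
lemma lintegral_haarGL_mapVecs {B : Mat M} (hB : B.det ≠ 0) {f : (Fin M → Vec M) → ENNReal}
    (hf : Measurable f) : ∫⁻ A, f (mapVecs B A) ∂(haarGL M) = ∫⁻ A, f A ∂(haarGL M) := by
  have hw := measurable_haarGL_density (M := M)
  have hm := (continuous_mapVecs (k := M) B).measurable
  rw [haarGL, lintegral_withDensity_eq_lintegral_mul _ hw (by fun_prop),
    lintegral_withDensity_eq_lintegral_mul _ hw hf]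
  have hG : Measurable fun A : Fin M → Vec M =>
    ENNReal.ofReal (|(rowMat A).det| ^ M)⁻¹ * f A := hw.mul hf
  have hG' : Measurable fun A : Fin M → Vec M =>
    ENNReal.ofReal (|(rowMat (mapVecs B A)).det| ^ M)⁻¹ * f (mapVecs B A) := hG.comp hm
  have hB' : |B.det| ^ M ≠ 0 := pow_ne_zero _ (abs_ne_zero.2 hB)
  calc _ = ∫⁻ A, ENNReal.ofReal (|B.det| ^ M) *
        (ENNReal.ofReal (|(rowMat (mapVecs B A)).det| ^ M)⁻¹ * f (mapVecs B A)) := by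
        refine lintegral_congr fun A => ?_
        simp only [Pi.mul_apply]
        rw [← mul_assoc, ← ENNReal.ofReal_mul (by positivity), rowMat_mapVecs, Matrix.det_mul,
          Matrix.det_transpose, abs_mul, mul_pow, mul_inv, mul_left_comm, mul_inv_cancel₀ hB',
          mul_one]
    _ = _ := by
        rw [lintegral_const_mul _ hG', lintegral_mapVecs hB hG, ← mul_assoc,
          ← ENNReal.ofReal_mul (by positivity), mul_inv_cancel₀ hB', ENNReal.ofReal_one, one_mul]
        rfl

lemma measurable_rowMat_mul_transpose :
    Measurable fun A : Fin M → Vec M => rowMat A * (rowMat A).transpose := by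
  have := continuous_rowMat (M := M) (k := M)
  have h : Continuous fun A : Fin M → Vec M => rowMat A * (rowMat A).transpose := by fun_prop
  exact h.measurable

/-- A measure carried by the cone of positive definite matrices that is invariant under all
congruences `V ↦ A V Aᵀ` with `A` invertible. -/
structure IsCongrInvariant (ρ : Measure (Mat M)) : Prop where
  ae_posDef : ∀ᵐ V ∂ρ, V.PosDef
  lintegral_congr : ∀ A : Mat M, A.det ≠ 0 → ∀ f : Mat M → ENNReal, Measurable f →
    ∫⁻ V, f (A * V * A.transpose) ∂ρ = ∫⁻ V, f V ∂ρ

/-- The Fubini argument for uniqueness: an invariant measure `ρ` on the cone is determined, up to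
the factor `∫ h(V⁻¹) dρ(V)`, by Haar measure on the group. -/
theorem lintegral_mul_lintegral_haarGL {ρ : Measure (Mat M)} [SFinite ρ] (hρ : IsCongrInvariant ρ)
    {f h : Mat M → ENNReal} (hf : Measurable f) (hh : Measurable h) :
    (∫⁻ V, f V ∂ρ) * ∫⁻ A, h (rowMat A * (rowMat A).transpose) ∂(haarGL M) =
      (∫⁻ V, h V⁻¹ ∂ρ) * ∫⁻ A, f (rowMat A * (rowMat A).transpose) ∂(haarGL M) := by
  have hcR := continuous_rowMat (M := M) (k := M)
  have hT := measurable_rowMat_mul_transpose (M := M)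
  have hT2 : Measurable fun p : (Fin M → Vec M) × Mat M =>
      rowMat p.1 * p.2 * (rowMat p.1).transpose := by
    have : Continuous fun p : (Fin M → Vec M) × Mat M =>
      rowMat p.1 * p.2 * (rowMat p.1).transpose := by fun_prop
    exact this.measurable
  have hhinv : Measurable fun V : Mat M => h V⁻¹ := hh.comp measurable_inv_mat
  have hmeas : Measurable fun p : (Fin M → Vec M) × Mat M =>
      h (rowMat p.1 * (rowMat p.1).transpose) * f (rowMat p.1 * p.2 * (rowMat p.1).transpose) :=
    (hh.comp (hT.comp measurable_fst)).mul (hf.comp hT2)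
  have hmeas' : Measurable fun p : (Fin M → Vec M) × Mat M =>
      h (rowMat p.1 * p.2⁻¹ * (rowMat p.1).transpose) * f (rowMat p.1 * (rowMat p.1).transpose) :=
    (hh.comp (hT2.comp (measurable_fst.prodMk (measurable_inv_mat.comp measurable_snd)))).mul
      (hf.comp (hT.comp measurable_fst))
  calc _ = ∫⁻ A, ∫⁻ V, h (rowMat A * (rowMat A).transpose) *
        f (rowMat A * V * (rowMat A).transpose) ∂ρ ∂(haarGL M) := by
        rw [← lintegral_const_mul _ (by fun_prop)]
        refine lintegral_congr_ae ?_
        filter_upwards [ae_haarGL_det_ne_zero] with A hA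
        rw [lintegral_const_mul _ (hf.fun_comp (measurable_congr (rowMat A))),
          hρ.lintegral_congr _ hA f hf, mul_comm]
    _ = ∫⁻ V, ∫⁻ A, h (rowMat A * (rowMat A).transpose) *
        f (rowMat A * V * (rowMat A).transpose) ∂(haarGL M) ∂ρ :=
        lintegral_lintegral_swap hmeas.aemeasurable
    _ = ∫⁻ V, ∫⁻ A, h (rowMat A * V⁻¹ * (rowMat A).transpose) *
        f (rowMat A * (rowMat A).transpose) ∂(haarGL M) ∂ρ := by
        refine lintegral_congr_ae ?_
        filter_upwards [hρ.ae_posDef] with V hV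
        have hs := sqrt_mul_sqrt hV.inv.posSemidef
        have hst := transpose_sqrt V⁻¹
        have hd : (CFC.sqrt V⁻¹).det ≠ 0 :=
          det_ne_zero_of_mul_transpose hV.inv (by rw [hst, hs])
        -- substitute `A V^(-1/2)` for `A`
        have hone : CFC.sqrt V⁻¹ * V * CFC.sqrt V⁻¹ = 1 := by
          have h1 : CFC.sqrt V⁻¹ * (CFC.sqrt V⁻¹ * V) = 1 := by
            rw [← Matrix.mul_assoc, hs, (posDef_mul_inv hV).2]
          exact mul_eq_one_comm.1 h1
        have hmV : Measurable fun A : Fin M → Vec M => h (rowMat A * (rowMat A).transpose) *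
            f (rowMat A * V * (rowMat A).transpose) := hmeas.comp measurable_prodMk_right
        rw [← lintegral_haarGL_mapVecs hd hmV]
        refine lintegral_congr fun A => ?_
        simp only [rowMat_mapVecs, hst, Matrix.transpose_mul]
        congr 2
        · calc _ = rowMat A * (CFC.sqrt V⁻¹ * CFC.sqrt V⁻¹) * (rowMat A).transpose := by
                simp only [Matrix.mul_assoc]
            _ = _ := by rw [hs]
        · calc _ = rowMat A * (CFC.sqrt V⁻¹ * V * CFC.sqrt V⁻¹) * (rowMat A).transpose := by
                simp only [Matrix.mul_assoc]
            _ = _ := by rw [hone, Matrix.mul_one]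
    _ = ∫⁻ A, ∫⁻ V, h (rowMat A * V⁻¹ * (rowMat A).transpose) *
        f (rowMat A * (rowMat A).transpose) ∂ρ ∂(haarGL M) :=
        (lintegral_lintegral_swap hmeas'.aemeasurable).symm
    _ = _ := by
        rw [← lintegral_const_mul _ (by fun_prop)]
        refine lintegral_congr_ae ?_
        filter_upwards [ae_haarGL_det_ne_zero] with A hA
        rw [lintegral_mul_const _ ((hh.fun_comp (measurable_congr (rowMat A))).fun_comp
          measurable_inv_mat)]
        congr 1
        have hu : IsUnit (rowMat A).det := isUnit_iff_ne_zero.2 hA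
        have hd : ((rowMat A)⁻¹.transpose).det ≠ 0 := by
          rw [Matrix.det_transpose, Matrix.det_nonsing_inv, Ring.inverse_eq_inv']
          exact inv_ne_zero hA
        rw [← hρ.lintegral_congr _ hd _ hhinv]
        refine lintegral_congr fun V => ?_
        rw [Matrix.mul_inv_rev, Matrix.mul_inv_rev, Matrix.transpose_transpose,
          Matrix.nonsing_inv_nonsing_inv _ hu, Matrix.transpose_nonsing_inv,
          Matrix.nonsing_inv_nonsing_inv _ (by rwa [Matrix.det_transpose]), Matrix.mul_assoc]

/-- An invariant measure is a multiple of any invariant measure that is positive and finite on some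
function. -/
theorem IsCongrInvariant.exists_smul_eq {ρ₁ ρ₂ : Measure (Mat M)} [SFinite ρ₁] [SFinite ρ₂]
    (h₁ : IsCongrInvariant ρ₁) (h₂ : IsCongrInvariant ρ₂) {g : Mat M → ENNReal} (hg : Measurable g)
    (hg0 : ∫⁻ V, g V ∂ρ₂ ≠ 0) (hgt : ∫⁻ V, g V ∂ρ₂ ≠ ⊤) :
    ∃ c : ENNReal, ρ₁ = c • ρ₂ := by
  -- a density whose integral against Haar measure is a Gaussian integral
  set h : Mat M → ENNReal := fun V => ENNReal.ofReal (V.det ^ ((M : ℝ) / 2) *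
    ((√((2 * Real.pi) ^ M) ^ M)⁻¹ * Real.exp (-(V.trace / 2)))) with hh
  have hm : Measurable h := by
    have h1 := measurable_det (M := M)
    have h2 := measurable_trace (M := M)
    fun_prop
  have hcR := continuous_rowMat (M := M) (k := M)
  have hT := measurable_rowMat_mul_transpose (M := M)
  have hone : ∫⁻ A, h (rowMat A * (rowMat A).transpose) ∂(haarGL M) = 1 := by
    have hG : ∫⁻ A : Fin M → Vec M, ENNReal.ofReal
        ((√((2 * Real.pi) ^ M) ^ M)⁻¹ * Real.exp (-((gram A).trace / 2))) = 1 := by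
      have h : Measure.pi (fun _ : Fin M => stdGaussian (Vec M)) Set.univ = 1 := measure_univ
      rwa [pi_stdGaussian_eq_withDensity, withDensity_apply _ MeasurableSet.univ,
        Measure.restrict_univ] at h
    rw [haarGL, lintegral_withDensity_eq_lintegral_mul _ measurable_haarGL_density (by fun_prop),
      ← hG]
    refine lintegral_congr_ae ?_
    filter_upwards [ae_det_rowMat_ne_zero] with A hA
    have hp : 0 < |(rowMat A).det| := abs_pos.2 hA
    simp only [Pi.mul_apply, hh]
    rw [← ENNReal.ofReal_mul (by positivity), Matrix.det_mul, Matrix.det_transpose, ← pow_two,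
      ← sq_abs, ← Real.rpow_natCast _ 2, ← Real.rpow_mul hp.le, Matrix.trace_mul_comm,
      ← gram_eq_transpose_mul, ← mul_assoc]
    congr 1
    rw [show ((2 : ℕ) : ℝ) * ((M : ℝ) / 2) = M by push_cast; ring, Real.rpow_natCast,
      inv_mul_cancel₀ (by positivity), one_mul]
  have key {ρ : Measure (Mat M)} [SFinite ρ] (hρ : IsCongrInvariant ρ) {f : Mat M → ENNReal}
      (hf : Measurable f) : ∫⁻ V, f V ∂ρ =
        (∫⁻ V, h V⁻¹ ∂ρ) * ∫⁻ A, f (rowMat A * (rowMat A).transpose) ∂(haarGL M) := by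
    have := lintegral_mul_lintegral_haarGL hρ hf hm
    rwa [hone, mul_one] at this
  have hb0 : ∫⁻ V, h V⁻¹ ∂ρ₂ ≠ 0 := by
    rw [key h₂ hg] at hg0
    exact left_ne_zero_of_mul hg0
  have hbt : ∫⁻ V, h V⁻¹ ∂ρ₂ ≠ ⊤ := fun htop => by
    rw [key h₂ hg] at hg0 hgt
    rw [htop, ENNReal.top_mul (right_ne_zero_of_mul hg0)] at hgt
    exact hgt rfl
  refine ⟨(∫⁻ V, h V⁻¹ ∂ρ₁) / ∫⁻ V, h V⁻¹ ∂ρ₂, Measure.ext_of_lintegral _ fun f hf => ?_⟩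
  rw [lintegral_smul_measure, key h₁ hf, key h₂ hf, smul_eq_mul, ← mul_assoc,
    ENNReal.div_mul_cancel hb0 hbt]

/-! ### The invariant measure, inversion and the Wishart density -/

/-- The invariant measure `det(V)^(-(M+1)/2) dV` on the cone. -/
def invMeasure (M : ℕ) : Measure (Mat M) :=
  (posDefLebesgue M).withDensity fun V => ENNReal.ofReal (V.det ^ (-(((M : ℝ) + 1) / 2)))

instance instSFiniteInvMeasure : SFinite (invMeasure M) := by
  unfold invMeasure
  infer_instance

lemma measurable_det_rpow (a : ℝ) : Measurable fun V : Mat M => ENNReal.ofReal (V.det ^ a) :=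
  (measurable_det.pow_const a).ennreal_ofReal

lemma lintegral_invMeasure {f : Mat M → ENNReal} (hf : Measurable f) :
    ∫⁻ V, f V ∂(invMeasure M) =
      ∫⁻ V, ENNReal.ofReal (V.det ^ (-(((M : ℝ) + 1) / 2))) * f V ∂(posDefLebesgue M) :=
  lintegral_withDensity_eq_lintegral_mul _ (measurable_det_rpow _) hf

lemma lintegral_posDefLebesgue {f : Mat M → ENNReal} (hf : Measurable f) :
    ∫⁻ V, f V ∂(posDefLebesgue M) =
      ∫⁻ V, ENNReal.ofReal (V.det ^ (((M : ℝ) + 1) / 2)) * f V ∂(invMeasure M) := by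
  rw [lintegral_invMeasure ((measurable_det_rpow _).fun_mul hf)]
  refine lintegral_congr_ae ?_
  filter_upwards [ae_posDef_posDefLebesgue] with V hV
  have := hV.det_pos
  rw [← mul_assoc, ← ENNReal.ofReal_mul (by positivity), ← Real.rpow_add this, neg_add_cancel,
    Real.rpow_zero, ENNReal.ofReal_one, one_mul]

lemma ae_posDef_invMeasure : ∀ᵐ V ∂(invMeasure M), V.PosDef :=
  (withDensity_absolutelyContinuous _ _).ae_le ae_posDef_posDefLebesgue

lemma isCongrInvariant_invMeasure : IsCongrInvariant (invMeasure M) where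
  ae_posDef := ae_posDef_invMeasure
  lintegral_congr A hA f hf := by
    rw [lintegral_invMeasure (hf.fun_comp (measurable_congr A)), lintegral_invMeasure hf,
      lintegral_congr_posDefLebesgue hA ((measurable_det_rpow _).fun_mul hf),
      ← lintegral_const_mul _ (((measurable_det_rpow _).fun_mul hf).fun_comp (measurable_congr A))]
    refine lintegral_congr_ae ?_
    filter_upwards [ae_posDef_posDefLebesgue] with V hV
    have hV0 := hV.det_pos
    have hA0 : 0 < |A.det| := abs_pos.2 hA
    rw [← mul_assoc, ← ENNReal.ofReal_mul (by positivity)]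
    congr 2
    have hd : (A * V * A.transpose).det = |A.det| ^ (2 : ℝ) * V.det := by
      rw [Matrix.det_mul, Matrix.det_mul, Matrix.det_transpose, Real.rpow_two, sq_abs]
      ring
    rw [hd, Real.mul_rpow (by positivity) hV0.le, ← Real.rpow_mul hA0.le, ← mul_assoc,
      ← Real.rpow_natCast, ← Real.rpow_add hA0]
    have : ((M + 1 : ℕ) : ℝ) + 2 * -(((M : ℝ) + 1) / 2) = 0 := by push_cast; ring
    rw [this, Real.rpow_zero, one_mul]

/-- The invariant measure is positive and finite on some function. -/
lemma exists_lintegral_invMeasure :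
    ∃ f : Mat M → ENNReal, Measurable f ∧ ∫⁻ V, f V ∂(invMeasure M) ≠ 0 ∧
      ∫⁻ V, f V ∂(invMeasure M) ≠ ⊤ := by
  obtain ⟨g, hg0, hgm, hg⟩ := exists_pos_lintegral_lt_of_sigmaFinite
    (volume : Measure ({p : Fin M × Fin M // p.1 ≤ p.2} → ℝ)) one_ne_zero
  have hgu : Measurable fun V : Mat M => (g (upperPart V) : ENNReal) :=
    (hgm.comp measurable_upperPart).coe_nnreal_ennreal
  refine ⟨fun V => ENNReal.ofReal (V.det ^ (((M : ℝ) + 1) / 2)) * g (upperPart V),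
    (measurable_det_rpow _).mul hgu, ?_, ?_⟩
  · rw [← lintegral_posDefLebesgue hgu]
    rw [Ne, lintegral_eq_zero_iff hgu]
    intro h0
    refine posDefLebesgue_ne_zero (M := M) ?_
    have hF : ∀ᵐ V ∂(posDefLebesgue M), False := by
      filter_upwards [h0] with V hV
      exact (hg0 (upperPart V)).ne' (by simpa using hV)
    simpa [ae_iff] using hF
  · rw [← lintegral_posDefLebesgue hgu]
    refine ne_top_of_lt (lt_of_le_of_lt ?_ (hg.trans ENNReal.one_lt_top))
    calc _ ≤ ∫⁻ V, g (upperPart V) ∂(symLebesgue M) :=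
        lintegral_mono' Measure.restrict_le_self le_rfl
      _ = _ := by
        rw [symLebesgue, lintegral_map hgu continuous_symOfUpper.measurable]
        simp_rw [upperPart_symOfUpper]

/-- The map `V ↦ V⁻¹` preserves the invariant measure: its image is invariant, hence a multiple
`c` of it, and `c ^ 2 = 1` since inversion is an involution. -/
theorem lintegral_inv_invMeasure {f : Mat M → ENNReal} (hf : Measurable f) :
    ∫⁻ V, f V⁻¹ ∂(invMeasure M) = ∫⁻ V, f V ∂(invMeasure M) := by
  have hm := measurable_inv_mat (M := M)
  have hinv : IsCongrInvariant ((invMeasure M).map fun V => V⁻¹) := by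
    constructor
    · rw [ae_map_iff hm.aemeasurable measurableSet_posDef]
      filter_upwards [ae_posDef_invMeasure] with V hV using hV.inv
    · intro A hA f hf
      have hu : IsUnit A.det := isUnit_iff_ne_zero.2 hA
      have hd : (A⁻¹.transpose).det ≠ 0 := by
        rw [Matrix.det_transpose, Matrix.det_nonsing_inv, Ring.inverse_eq_inv']
        exact inv_ne_zero hA
      rw [lintegral_map (hf.fun_comp (measurable_congr A)) hm, lintegral_map hf hm,
        ← isCongrInvariant_invMeasure.lintegral_congr _ hd _ (hf.fun_comp hm)]
      refine lintegral_congr fun V => ?_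
      rw [Matrix.mul_inv_rev, Matrix.mul_inv_rev, Matrix.transpose_transpose,
        Matrix.nonsing_inv_nonsing_inv _ hu, Matrix.transpose_nonsing_inv,
        Matrix.nonsing_inv_nonsing_inv _ (by rwa [Matrix.det_transpose]), Matrix.mul_assoc]
  obtain ⟨g, hg, hg0, hgt⟩ := exists_lintegral_invMeasure (M := M)
  have hinvinv : ∀ {g : Mat M → ENNReal}, Measurable g →
      ∫⁻ V, g V⁻¹⁻¹ ∂(invMeasure M) = ∫⁻ V, g V ∂(invMeasure M) := fun _ => by
    refine lintegral_congr_ae ?_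
    filter_upwards [ae_posDef_invMeasure] with V hV
    rw [Matrix.nonsing_inv_nonsing_inv _ (isUnit_iff_ne_zero.2 hV.det_pos.ne')]
  obtain ⟨c, hc⟩ := hinv.exists_smul_eq isCongrInvariant_invMeasure hg hg0 hgt
  have hc' {f : Mat M → ENNReal} (hf : Measurable f) :
      ∫⁻ V, f V⁻¹ ∂(invMeasure M) = c * ∫⁻ V, f V ∂(invMeasure M) := by
    rw [← lintegral_map hf hm, hc, lintegral_smul_measure, smul_eq_mul]
  have hcc : c * c = 1 := by
    have h := hc' (hg.fun_comp hm)
    rw [hinvinv hg, hc' hg, ← mul_assoc] at h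
    exact ((ENNReal.mul_left_inj hg0 hgt).1 (h.symm.trans (one_mul _).symm))
  have hc1 : c = 1 := by
    rcases lt_trichotomy c 1 with hlt | heq | hgt
    · exact absurd hcc ((mul_le_of_le_one_right' hlt.le).trans_lt hlt).ne
    · exact heq
    · exact absurd hcc (hgt.trans_le (le_mul_of_one_le_right' hgt.le)).ne'
  rw [hc' hf, hc1, one_mul]

lemma measurable_wishart_density (a b : ℝ) :
    Measurable fun V : Mat M => ENNReal.ofReal (V.det ^ a * etr (b • V)) := by
  have h1 := (measurable_det (M := M)).pow_const a
  have h2 : Measurable fun V : Mat M => etr (b • V) := by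
    have := measurable_trace (M := M)
    simp only [etr, Matrix.trace_smul, smul_eq_mul]
    fun_prop
  exact (h1.mul h2).ennreal_ofReal

lemma wishart_one_eq_map :
    wishart (1 : Mat M) k = (Measure.pi fun _ : Fin k => stdGaussian (Vec M)).map gram := by
  rw [wishart, multivariateGaussian_zero_one]
  rfl

lemma lintegral_wishart {f : Mat M → ENNReal} (hf : Measurable f) :
    ∫⁻ V, f V ∂(wishart 1 k) =
      ∫⁻ Z : Fin k → Vec M, ENNReal.ofReal
        ((√((2 * Real.pi) ^ M) ^ k)⁻¹ * Real.exp (-((gram Z).trace / 2))) * f (gram Z) := by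
  have hgm := (continuous_gram (M := M) (k := k)).measurable
  have ht := measurable_trace (M := M)
  rw [wishart_one_eq_map, lintegral_map hf hgm, pi_stdGaussian_eq_withDensity,
    lintegral_withDensity_eq_lintegral_mul _ (by fun_prop) (by fun_prop)]
  rfl

lemma ae_posDef_wishart (h : M ≤ k) : ∀ᵐ V ∂(wishart (1 : Mat M) k), V.PosDef := by
  have hgm := (continuous_gram (M := M) (k := k)).measurable
  rw [wishart_one_eq_map, ae_map_iff hgm.aemeasurable measurableSet_posDef,
    pi_stdGaussian_eq_withDensity]
  exact (withDensity_absolutelyContinuous _ _).ae_le (ae_posDef_gram h)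

instance instIsProbabilityMeasureWishart (V : Mat M) : IsProbabilityMeasure (wishart V k) := by
  unfold wishart
  refine Measure.isProbabilityMeasure_map ?_
  exact (continuous_gram (M := M) (k := k)).measurable.aemeasurable

/-- The Wishart law has a density proportional to `det(V)^(k/2) etr(-V/2)` with respect to the
invariant measure: the law of `Z Zᵀ` for `Z` distributed as Lebesgue measure becomes invariant
when multiplied by `det^(-k/2)`. -/
lemma exists_lintegral_wishart (h : M ≤ k) :
    ∃ c : ENNReal, ∀ f : Mat M → ENNReal, Measurable f →
      ∫⁻ V, f V ∂(wishart 1 k) = c * ∫⁻ V, ENNReal.ofReal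
        (V.det ^ ((k : ℝ) / 2) * etr ((-(1 / 2) : ℝ) • V)) * f V ∂(invMeasure M) := by
  have hgm := (continuous_gram (M := M) (k := k)).measurable
  set C : ENNReal := ENNReal.ofReal (√((2 * Real.pi) ^ M) ^ k)⁻¹ with hC
  set ρ : Measure (Mat M) := ((volume : Measure (Fin k → Vec M)).map gram).withDensity
    fun V => ENNReal.ofReal (V.det ^ (-((k : ℝ) / 2))) with hρ
  have hρi {f : Mat M → ENNReal} (hf : Measurable f) : ∫⁻ V, f V ∂ρ =
      ∫⁻ Z : Fin k → Vec M, ENNReal.ofReal ((gram Z).det ^ (-((k : ℝ) / 2))) * f (gram Z) := by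
    rw [hρ, lintegral_withDensity_eq_lintegral_mul _ (measurable_det_rpow _) hf,
      lintegral_map ((measurable_det_rpow _).mul hf) hgm]
    rfl
  have hinv : IsCongrInvariant ρ := by
    constructor
    · refine (withDensity_absolutelyContinuous _ _).ae_le
        ((ae_map_iff hgm.aemeasurable measurableSet_posDef).2 ?_)
      exact ae_posDef_gram h
    · intro A hA f hf
      have hA0 : 0 < |A.det| := abs_pos.2 hA
      have hG : Measurable fun Z : Fin k → Vec M =>
          ENNReal.ofReal ((gram Z).det ^ (-((k : ℝ) / 2))) * f (gram Z) :=
        ((measurable_det_rpow _).fun_mul hf).comp hgm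
      rw [hρi (hf.fun_comp (measurable_congr A)), hρi hf]
      calc _ = ∫⁻ Z : Fin k → Vec M, ENNReal.ofReal (|A.det| ^ k) * (ENNReal.ofReal
            ((gram (mapVecs A Z)).det ^ (-((k : ℝ) / 2))) * f (gram (mapVecs A Z))) := by
            refine lintegral_congr fun Z => ?_
            rw [gram_mapVecs, ← mul_assoc, ← ENNReal.ofReal_mul (by positivity)]
            congr 2
            have hd : (A * gram Z * A.transpose).det = |A.det| ^ (2 : ℝ) * (gram Z).det := by
              rw [Matrix.det_mul, Matrix.det_mul, Matrix.det_transpose, Real.rpow_two, sq_abs]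
              ring
            rw [hd, Real.mul_rpow (by positivity) (posSemidef_gram Z).det_nonneg,
              ← Real.rpow_mul hA0.le, ← mul_assoc,
              ← Real.rpow_natCast, ← Real.rpow_add hA0]
            have : (k : ℝ) + 2 * -((k : ℝ) / 2) = 0 := by ring
            rw [this, Real.rpow_zero, one_mul]
        _ = _ := by
            rw [lintegral_const_mul _ (hG.fun_comp (continuous_mapVecs A).measurable),
              lintegral_mapVecs hA hG, ← mul_assoc, ← ENNReal.ofReal_mul (by positivity),
              mul_inv_cancel₀ (by positivity), ENNReal.ofReal_one, one_mul]
  have hw := measurable_wishart_density (M := M) ((k : ℝ) / 2) (-(1 / 2))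
  have hW {f : Mat M → ENNReal} (hf : Measurable f) : ∫⁻ V, f V ∂(wishart 1 k) =
      C * ∫⁻ V, ENNReal.ofReal (V.det ^ ((k : ℝ) / 2) * etr ((-(1 / 2) : ℝ) • V)) * f V ∂ρ := by
    rw [lintegral_wishart hf, hρi (hw.fun_mul hf), ← lintegral_const_mul]
    · refine lintegral_congr_ae ?_
      filter_upwards [ae_posDef_gram h] with Z hZ
      have := hZ.det_pos
      rw [hC, ← mul_assoc, ← mul_assoc, ← ENNReal.ofReal_mul (by positivity),
        ← ENNReal.ofReal_mul (by positivity)]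
      congr 2
      rw [mul_assoc, ← mul_assoc ((gram Z).det ^ _), ← Real.rpow_add this, neg_add_cancel,
        Real.rpow_zero, one_mul, etr, Matrix.trace_smul, smul_eq_mul]
      congr 2
      ring
    · exact (((measurable_det_rpow _).fun_mul (hw.fun_mul hf)).fun_comp hgm)
  obtain ⟨g, hg, hg0, hgt⟩ := exists_lintegral_invMeasure (M := M)
  obtain ⟨c, hc⟩ := hinv.exists_smul_eq isCongrInvariant_invMeasure hg hg0 hgt
  refine ⟨C * c, fun f hf => ?_⟩
  rw [hW hf, hc, lintegral_smul_measure, smul_eq_mul, mul_assoc]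

lemma etr_nonneg (V : Mat M) : 0 ≤ etr V := (Real.exp_pos _).le

lemma multiGamma_eq_toReal (a : ℝ) :
    multiGamma M a =
      (∫⁻ V, ENNReal.ofReal (V.det ^ a * etr ((-1 : ℝ) • V)) ∂(invMeasure M)).toReal := by
  have hm : Measurable fun V : Mat M => V.det ^ (a - ((M : ℝ) + 1) / 2) * etr (-V) := by
    refine (measurable_det.pow_const _).mul ?_
    have := measurable_trace (M := M)
    simp only [etr, Matrix.trace_neg]
    fun_prop
  rw [multiGamma, integral_eq_lintegral_of_nonneg_ae ?_ hm.aestronglyMeasurable,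
    lintegral_invMeasure (measurable_wishart_density _ _)]
  · congr 1
    refine lintegral_congr_ae ?_
    filter_upwards [ae_posDef_posDefLebesgue] with V hV
    have := hV.det_pos
    rw [← ENNReal.ofReal_mul (by positivity), ← mul_assoc, ← Real.rpow_add this, neg_one_smul,
      sub_eq_neg_add]
  · filter_upwards [ae_posDef_posDefLebesgue] with V hV
    have := hV.det_pos
    have := etr_nonneg (-V)
    simp only [Pi.zero_apply]
    positivity

/-- The substitution of `2 V` for `V` passes from the exponent of the Wishart density to that of the
multivariate gamma function. -/
lemma lintegral_half_scale (a : ℝ) :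
    ∫⁻ V, ENNReal.ofReal (V.det ^ a * etr ((-(1 / 2) : ℝ) • V)) ∂(invMeasure M) =
      ENNReal.ofReal (2 ^ ((M : ℝ) * a)) *
        ∫⁻ V, ENNReal.ofReal (V.det ^ a * etr ((-1 : ℝ) • V)) ∂(invMeasure M) := by
  have hd : ((√2 : ℝ) • (1 : Mat M)).det ≠ 0 := by
    simp
  rw [← isCongrInvariant_invMeasure.lintegral_congr _ hd _ (measurable_wishart_density _ _),
    ← lintegral_const_mul _ (measurable_wishart_density _ _)]
  refine lintegral_congr_ae ?_
  filter_upwards [ae_posDef_invMeasure] with V hV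
  have h2 : ((√2 : ℝ) • (1 : Mat M)) * V * ((√2 : ℝ) • (1 : Mat M)).transpose = (2 : ℝ) • V := by
    simp [smul_smul]
  rw [h2, ← ENNReal.ofReal_mul (by positivity), Matrix.det_smul, smul_smul,
    Real.mul_rpow (by positivity) hV.det_pos.le, Fintype.card_fin, ← Real.rpow_natCast,
    ← Real.rpow_mul (by positivity), mul_assoc]
  norm_num

/-- The multivariate gamma function is finite and positive at the half-integers `k / 2 ≥ M / 2`,
because the Wishart law with `k` degrees of freedom has mass one. -/
lemma multiGamma_half (h : M ≤ k) :
    0 < multiGamma M ((k : ℝ) / 2) ∧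
      ∫⁻ V, ENNReal.ofReal (V.det ^ ((k : ℝ) / 2) * etr ((-1 : ℝ) • V)) ∂(invMeasure M) =
        ENNReal.ofReal (multiGamma M ((k : ℝ) / 2)) := by
  obtain ⟨c, hc⟩ := exists_lintegral_wishart h
  have h1 := hc (fun _ => 1) measurable_const
  simp only [lintegral_const, measure_univ, mul_one, lintegral_half_scale] at h1
  set J := ∫⁻ V, ENNReal.ofReal (V.det ^ ((k : ℝ) / 2) * etr ((-1 : ℝ) • V)) ∂(invMeasure M)
    with hJ
  have hJ0 : J ≠ 0 := fun h0 => by simp [h0] at h1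
  have hJt : J ≠ ⊤ := fun h0 => by
    have h2 : ENNReal.ofReal (2 ^ ((M : ℝ) * ((k : ℝ) / 2))) ≠ 0 := by
      rw [Ne, ENNReal.ofReal_eq_zero, not_le]; positivity
    have hc0 : c ≠ 0 := fun h0 => by simp [h0] at h1
    rw [h0, ENNReal.mul_top h2, ENNReal.mul_top hc0] at h1
    exact ENNReal.top_ne_one h1.symm
  rw [multiGamma_eq_toReal, ← hJ, ENNReal.ofReal_toReal hJt]
  exact ⟨ENNReal.toReal_pos hJ0 hJt, rfl⟩

/-- The Wishart density with respect to the invariant measure; its total mass fixes the constant. -/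
theorem lintegral_wishart_eq (h : M ≤ k) {f : Mat M → ENNReal} (hf : Measurable f) :
    ∫⁻ V, f V ∂(wishart 1 k) =
      ENNReal.ofReal (2 ^ ((M : ℝ) * k / 2) * multiGamma M ((k : ℝ) / 2))⁻¹ *
        ∫⁻ V, ENNReal.ofReal
          (V.det ^ ((k : ℝ) / 2) * etr ((-(1 / 2) : ℝ) • V)) * f V ∂(invMeasure M) := by
  obtain ⟨c, hc⟩ := exists_lintegral_wishart h
  have h1 := hc (fun _ => 1) measurable_const
  obtain ⟨hg, hg'⟩ := multiGamma_half h
  simp only [lintegral_const, measure_univ, mul_one, lintegral_half_scale, hg'] at h1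
  rw [← ENNReal.ofReal_mul (by positivity), ← mul_div_assoc] at h1
  rw [hc f hf, ENNReal.ofReal_inv_of_pos (by positivity)]
  congr 1
  exact ENNReal.eq_inv_of_mul_eq_one_left h1.symm

/-! ### Sufficiency -/

/-- The Fisher–Neyman factorisation criterion, for a family dominated by a probability measure:
the conditional law given the statistic under the dominating measure serves for all parameters. -/
theorem isSufficient_of_withDensity {Θ X T : Type*} [MeasurableSpace X] [StandardBorelSpace X]
    [Nonempty X] [MeasurableSpace T] {P : Θ → Measure X} {P₀ : Measure X} [IsProbabilityMeasure P₀]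
    {t : X → T} (ht : Measurable t) {g : Θ → T → ENNReal} (hg : ∀ θ, Measurable (g θ))
    (hP : ∀ θ, P θ = P₀.withDensity fun x => g θ (t x)) : IsSufficient P t := by
  refine ⟨ht, condDistrib id t P₀, inferInstance, fun θ => ?_⟩
  set κ := condDistrib id t P₀
  have hκ : (P₀.map t) ⊗ₘ κ = P₀.map fun x => (t x, x) :=
    compProd_map_condDistrib measurable_id.aemeasurable
  have hpair : Measurable fun x => (t x, x) := ht.prodMk measurable_id
  have hgt : Measurable fun x => g θ (t x) := (hg θ).comp ht
  have : SFinite ((P θ).map t) := by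
    rw [hP]
    infer_instance
  refine Measure.ext_of_lintegral _ fun f hf => ?_
  have hF : Measurable fun p : T × X => g θ p.1 * f p := ((hg θ).comp measurable_fst).mul hf
  have hI : Measurable fun s => ∫⁻ x, f (s, x) ∂(κ s) := hf.lintegral_kernel_prod_right'
  have hIt : Measurable fun x => ∫⁻ y, f (t x, y) ∂(κ (t x)) := hI.comp ht
  rw [lintegral_map hf hpair, hP, lintegral_withDensity_eq_lintegral_mul _ hgt (by fun_prop)]
  change ∫⁻ x, g θ (t x) * f (t x, x) ∂P₀ = _
  rw [← lintegral_map hF hpair, ← hκ, Measure.lintegral_compProd hF, Measure.lintegral_compProd hf,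
    lintegral_map hF.lintegral_kernel_prod_right' ht, lintegral_map hI ht,
    lintegral_withDensity_eq_lintegral_mul _ hgt hIt]
  refine lintegral_congr fun x => ?_
  exact lintegral_const_mul (g θ (t x)) (hf.fun_comp (measurable_prodMk_left (x := t x)))

lemma likelihood_eq (hn : n ≠ 0) (x : Fin n → Vec M) (m : Vec M) (S : Mat M) :
    likelihood x m S = ((√((2 * Real.pi) ^ M * S.det)) ^ n)⁻¹ *
      Real.exp (-(1 / 2) * ((S⁻¹ * sigmaHat x).trace +
        n * ((muHat x - m).ofLp ⬝ᵥ S⁻¹.mulVec (muHat x - m).ofLp))) := by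
  simp only [likelihood, gaussDensity]
  rw [Finset.prod_mul_distrib, ← Real.exp_sum, ← Finset.mul_sum, sum_dotProduct_sub hn]
  simp

theorem isSufficient_muHat_sigmaHat (hn : n ≠ 0) :
    IsSufficient (fun θ : {p : Vec M × Mat M // p.2.PosDef} => sampleLaw M n θ.1.1 θ.1.2)
      (fun x => (muHat x, sigmaHat x)) := by
  -- the likelihood as a function of the statistic
  set G : Vec M → Mat M → Vec M × Mat M → ℝ := fun m S t =>
    ((√((2 * Real.pi) ^ M * S.det)) ^ n)⁻¹ * Real.exp (-(1 / 2) * ((S⁻¹ * t.2).trace +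
        n * ((t.1 - m).ofLp ⬝ᵥ S⁻¹.mulVec (t.1 - m).ofLp))) with hG
  have hGm (m : Vec M) (S : Mat M) : Measurable (G m S) := by
    have : Continuous (G m S) := by fun_prop
    exact this.measurable
  have hGt (x : Fin n → Vec M) (m : Vec M) (S : Mat M) :
      likelihood x m S = G m S (muHat x, sigmaHat x) := likelihood_eq hn x m S
  have ht : Measurable fun x : Fin n → Vec M => (muHat x, sigmaHat x) :=
    continuous_muHat.measurable.prodMk continuous_sigmaHat.measurable
  have : IsProbabilityMeasure (sampleLaw M n (0 : Vec M) 1) := by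
    unfold sampleLaw
    infer_instance
  refine isSufficient_of_withDensity (P₀ := sampleLaw M n 0 1) ht
    (g := fun θ t => ENNReal.ofReal (G θ.1.1 θ.1.2 t / G 0 1 t))
    (fun θ => ((hGm _ _).div (hGm _ _)).ennreal_ofReal) fun θ => ?_
  rw [sampleLaw_eq_withDensity θ.2, sampleLaw_eq_withDensity Matrix.PosDef.one,
    ← withDensity_mul]
  · congr 1
    ext x
    have h0 : 0 < likelihood x (0 : Vec M) (1 : Mat M) := by
      rw [likelihood_zero_one]
      positivity
    simp only [Pi.mul_apply]
    rw [← ENNReal.ofReal_mul h0.le, ← hGt, ← hGt, mul_div_cancel₀ _ h0.ne']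
  · exact (measurable_likelihood measurable_id measurable_const measurable_const).ennreal_ofReal
  · exact (((hGm _ _).div (hGm _ _)).ennreal_ofReal).comp ht

/-! ### The joint law of the mean and the scatter matrix -/

/-- Linear combinations of the members of a family of vectors, with coefficients in a matrix. -/
def mixVecs (O : Matrix (Fin k) (Fin k) ℝ) : (Fin k → Vec M) →ₗ[ℝ] (Fin k → Vec M) where
  toFun Z i := ∑ j, O i j • Z j
  map_add' Z W := by ext; simp [Finset.sum_add_distrib]
  map_smul' c Z := by
    ext i a
    simp [Finset.mul_sum, mul_left_comm]

lemma mixVecs_apply (O : Matrix (Fin k) (Fin k) ℝ) (Z : Fin k → Vec M) (i : Fin k) :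
    mixVecs O Z i = ∑ j, O i j • Z j := rfl

lemma rowMat_mixVecs (O : Matrix (Fin k) (Fin k) ℝ) (Z : Fin k → Vec M) :
    rowMat (mixVecs O Z) = O * rowMat Z := by
  ext i j
  simp [rowMat, mixVecs_apply, Matrix.mul_apply]

lemma rowMat_injective : Function.Injective (rowMat (M := M) (k := k)) := by
  intro Z W h
  ext i j
  exact congrFun (congrFun h i) j

lemma gram_mixVecs {O : Matrix (Fin k) (Fin k) ℝ} (hO : O.transpose * O = 1)
    (Z : Fin k → Vec M) : gram (mixVecs O Z) = gram Z := by
  rw [gram_eq_transpose_mul, rowMat_mixVecs, Matrix.transpose_mul, Matrix.mul_assoc,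
    ← Matrix.mul_assoc O.transpose, hO, Matrix.one_mul, gram_eq_transpose_mul]

/-- The law of an iid standard Gaussian sample is invariant under orthogonal mixing. Lebesgue
measure is multiplied by a constant, the Gaussian density is unchanged, and the total mass is
one. -/
lemma map_mixVecs_pi_stdGaussian {O : Matrix (Fin k) (Fin k) ℝ} (hO : O.transpose * O = 1) :
    (Measure.pi fun _ : Fin k => stdGaussian (Vec M)).map (mixVecs O) =
      Measure.pi fun _ : Fin k => stdGaussian (Vec M) := by
  set P := Measure.pi fun _ : Fin k => stdGaussian (Vec M) with hP
  have hdet : LinearMap.det (mixVecs (M := M) O) ≠ 0 := by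
    have hcomp : mixVecs (M := M) O.transpose ∘ₗ mixVecs O = LinearMap.id := by
      refine LinearMap.ext fun Z => rowMat_injective ?_
      rw [LinearMap.comp_apply, rowMat_mixVecs, rowMat_mixVecs, ← Matrix.mul_assoc, hO,
        Matrix.one_mul, LinearMap.id_apply]
    have := congrArg LinearMap.det hcomp
    rw [LinearMap.det_comp, LinearMap.det_id] at this
    exact right_ne_zero_of_mul_eq_one this
  have hm : Measurable (mixVecs (M := M) O) :=
    (mixVecs O).continuous_of_finiteDimensional.measurable
  have hvol := Measure.map_linearMap_addHaar_eq_smul_addHaar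
    (volume : Measure (Fin k → Vec M)) hdet
  set c := ENNReal.ofReal |(LinearMap.det (mixVecs (M := M) O))⁻¹|
  have ht := measurable_trace (M := M)
  have hgm := (continuous_gram (M := M) (k := k)).measurable
  have hd : Measurable fun Z : Fin k → Vec M => ENNReal.ofReal
      ((√((2 * Real.pi) ^ M) ^ k)⁻¹ * Real.exp (-((gram Z).trace / 2))) := by fun_prop
  have hmap : P.map (mixVecs O) = c • P := by
    refine Measure.ext_of_lintegral _ fun f hf => ?_
    rw [lintegral_map hf hm, lintegral_smul_measure, smul_eq_mul, hP, pi_stdGaussian_eq_withDensity,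
      lintegral_withDensity_eq_lintegral_mul _ hd (by fun_prop),
      lintegral_withDensity_eq_lintegral_mul _ hd hf, ← smul_eq_mul (a := c),
      ← lintegral_smul_measure, ← hvol, lintegral_map (hd.mul hf) hm]
    simp only [Pi.mul_apply, gram_mixVecs hO]
  have h1 := congrArg (fun μ => μ Set.univ) hmap
  simp only [Measure.map_apply hm MeasurableSet.univ, Set.preimage_univ, measure_univ,
    Measure.smul_apply, smul_eq_mul, mul_one] at h1
  rw [hmap, ← h1, one_smul]

/-- An orthogonal matrix whose first row is constant. -/
lemma exists_orthogonal_first_row (l : ℕ) : ∃ O : Matrix (Fin (l + 1)) (Fin (l + 1)) ℝ,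
    O.transpose * O = 1 ∧ ∀ j, O 0 j = (√((l + 1 : ℕ) : ℝ))⁻¹ := by
  set u : EuclideanSpace ℝ (Fin (l + 1)) := WithLp.toLp 2 fun _ => (√((l + 1 : ℕ) : ℝ))⁻¹ with hu
  have hnorm : ‖u‖ = 1 := by
    rw [← sq_eq_sq₀ (norm_nonneg _) zero_le_one, EuclideanSpace.real_norm_sq_eq]
    have : ((l : ℝ) + 1) ≠ 0 := by positivity
    simp [hu, Real.sq_sqrt (show (0 : ℝ) ≤ l + 1 by positivity), this]
  obtain ⟨b, hb⟩ := Orthonormal.exists_orthonormalBasis_extension_of_card_eq (𝕜 := ℝ)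
    (ι := Fin (l + 1)) (E := EuclideanSpace ℝ (Fin (l + 1))) (by simp) (v := fun _ => u)
    (s := {0}) (by
      constructor
      · intro i; exact hnorm
      · intro i j hij; exact absurd (Subsingleton.elim i j) hij)
  refine ⟨Matrix.of fun i j => b i j, ?_, fun j => ?_⟩
  · refine mul_eq_one_comm.1 ?_
    ext i j
    have := orthonormal_iff_ite.1 b.orthonormal i j
    rw [PiLp.inner_apply] at this
    simp only [Matrix.mul_apply, Matrix.of_apply, Matrix.transpose_apply, Matrix.one_apply]
    rw [← this]
    exact Finset.sum_congr rfl fun a _ => by simp [mul_comm]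
  · simp [hb 0 rfl, hu]

lemma map_muHat_sigmaHat_pi_stdGaussian (hn : n ≠ 0) :
    (Measure.pi fun _ : Fin n => stdGaussian (Vec M)).map (fun x => (muHat x, sigmaHat x)) =
      (pivotLaw M n).map fun p => ((√n : ℝ)⁻¹ • p.1, p.2) := by
  obtain ⟨l, rfl⟩ := Nat.exists_eq_succ_of_ne_zero hn
  obtain ⟨O, hO, hO0⟩ := exists_orthogonal_first_row l
  have hgm := (continuous_gram (M := M) (k := l)).measurable
  have hm : Measurable (mixVecs (M := M) O) :=
    (mixVecs O).continuous_of_finiteDimensional.measurable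
  have hpos : (0 : ℝ) < ((l + 1 : ℕ) : ℝ) := by positivity
  have hW : wishart (1 : Mat M) (l + 1 - 1) =
      (Measure.pi fun _ : Fin l => stdGaussian (Vec M)).map gram := wishart_one_eq_map
  have hstat (Z : Fin (l + 1) → Vec M) : (muHat Z, sigmaHat Z) =
      ((√((l + 1 : ℕ) : ℝ))⁻¹ • mixVecs O Z 0, gram fun i : Fin l => mixVecs O Z i.succ) := by
    have h0 : mixVecs O Z 0 = √((l + 1 : ℕ) : ℝ) • muHat Z := by
      rw [mixVecs_apply]
      simp_rw [hO0]
      rw [← Finset.smul_sum, muHat, smul_smul]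
      congr 1
      have := Real.mul_self_sqrt hpos.le
      field_simp
      exact this.symm.trans (pow_two _).symm
    have hg := gram_mixVecs hO Z
    have h1 : gram (mixVecs O Z) = outer (mixVecs O Z 0) +
      gram fun i : Fin l => mixVecs O Z i.succ := Fin.sum_univ_succ _
    have h2 := sum_outer_sub hn Z 0
    simp only [sub_zero] at h2
    refine Prod.ext ?_ ?_
    · simp only [h0, smul_smul]
      rw [inv_mul_cancel₀ (Real.sqrt_pos.2 hpos).ne', one_smul]
    · simp only
      rw [h1, h0, outer_smul, Real.sq_sqrt hpos.le] at hg
      have h3 : gram Z = sigmaHat Z + ((l + 1 : ℕ) : ℝ) • outer (muHat Z) := h2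
      rw [h3, add_comm (sigmaHat Z)] at hg
      exact (add_left_cancel hg).symm
  have hmp := measurePreserving_piFinSuccAbove (fun _ : Fin (l + 1) => stdGaussian (Vec M)) 0
  have hF : Measurable fun p : Vec M × (Fin l → Vec M) =>
      ((√((l + 1 : ℕ) : ℝ))⁻¹ • p.1, gram p.2) := by fun_prop
  have hprod : pivotLaw M (l + 1) = ((stdGaussian (Vec M)).prod
      (Measure.pi fun _ : Fin l => stdGaussian (Vec M))).map (Prod.map id gram) := by
    rw [pivotLaw, hW, ← Measure.map_prod_map _ _ measurable_id hgm, Measure.map_id]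
  calc _ = ((Measure.pi fun _ : Fin (l + 1) => stdGaussian (Vec M)).map (mixVecs O)).map
        (fun w => ((√((l + 1 : ℕ) : ℝ))⁻¹ • w 0, gram fun i : Fin l => w i.succ)) := by
        rw [Measure.map_map _ hm]
        · congr 1
          ext1 Z
          exact hstat Z
        · fun_prop
    _ = ((Measure.pi fun _ : Fin (l + 1) => stdGaussian (Vec M)).map
          (MeasurableEquiv.piFinSuccAbove (fun _ => Vec M) 0)).map
            (fun p => ((√((l + 1 : ℕ) : ℝ))⁻¹ • p.1, gram p.2)) := by
        rw [map_mixVecs_pi_stdGaussian hO, Measure.map_map hF (MeasurableEquiv.measurable _)]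
        rfl
    _ = _ := by
        rw [hmp.map_eq, hprod, Measure.map_map (by fun_prop) (by fun_prop)]
        rfl

theorem map_muHat_sigmaHat_sampleLaw (hn : n ≠ 0) (m : Vec M) {Sigma S : Mat M}
    (hSig : Sigma.PosDef) (hS : S * S.transpose = Sigma) :
    (sampleLaw M n m Sigma).map (fun x => (muHat x, sigmaHat x)) =
      (pivotLaw M n).map (ssmStatistic n m S) := by
  have hnr : (n : ℝ) ≠ 0 := by exact_mod_cast hn
  have hc := (Matrix.toEuclideanLin S).continuous_of_finiteDimensional
  have ht : Measurable fun x : Fin n → Vec M => (muHat x, sigmaHat x) :=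
    continuous_muHat.measurable.prodMk continuous_sigmaHat.measurable
  have hsample : sampleLaw M n m Sigma = (Measure.pi fun _ : Fin n => stdGaussian (Vec M)).map
      fun z i => m + Matrix.toEuclideanLin S (z i) := by
    rw [sampleLaw, ← map_stdGaussian_eq_multivariateGaussian hSig hS m]
    have (_ : Fin n) : SigmaFinite ((stdGaussian (Vec M)).map
        fun z => m + Matrix.toEuclideanLin S z) := by
      have : IsProbabilityMeasure ((stdGaussian (Vec M)).map
        fun z => m + Matrix.toEuclideanLin S z) :=
        Measure.isProbabilityMeasure_map (by fun_prop)
      infer_instance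
    exact (Measure.pi_map_pi (μ := fun _ : Fin n => stdGaussian (Vec M))
      (f := fun _ z => m + Matrix.toEuclideanLin S z) fun _ => by fun_prop).symm
  have hmu (z : Fin n → Vec M) : muHat (fun i => m + Matrix.toEuclideanLin S (z i)) =
      m + Matrix.toEuclideanLin S (muHat z) := by
    simp only [muHat, Finset.sum_add_distrib, smul_add, map_smul, map_sum]
    simp [← Nat.cast_smul_eq_nsmul ℝ, smul_smul, hnr]
  have hsig (z : Fin n → Vec M) : sigmaHat (fun i => m + Matrix.toEuclideanLin S (z i)) =
      S * sigmaHat z * S.transpose := by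
    rw [sigmaHat_eq_gram z, ← gram_mapVecs, sigmaHat_eq_gram, hmu]
    congr 1
    ext1 i
    simp only [mapVecs, map_sub]
    abel
  have hA : Measurable fun p : Vec M × Mat M =>
      (m + Matrix.toEuclideanLin S p.1, S * p.2 * S.transpose) := by
    have := measurable_congr S
    fun_prop
  rw [hsample, Measure.map_map ht (by fun_prop)]
  calc _ = ((Measure.pi fun _ : Fin n => stdGaussian (Vec M)).map
        (fun x => (muHat x, sigmaHat x))).map
          (fun p => (m + Matrix.toEuclideanLin S p.1, S * p.2 * S.transpose)) := by
        rw [Measure.map_map hA ht]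
        congr 1
        ext1 z
        simp only [Function.comp, hmu, hsig]
    _ = _ := by
        rw [map_muHat_sigmaHat_pi_stdGaussian hn, Measure.map_map hA (by fun_prop)]
        congr 1
        ext1 p
        simp [ssmStatistic]

lemma ae_posDef_pivotLaw (hn : M < n) : ∀ᵐ p ∂(pivotLaw M n), p.2.PosDef :=
  Measure.quasiMeasurePreserving_snd.ae (ae_posDef_wishart (by omega))

theorem ae_posDef_sigmaHat (hn : M < n) (m : Vec M) {S : Mat M} (hS : S.PosDef) :
    ∀ᵐ x ∂(sampleLaw M n m S), (sigmaHat x).PosDef := by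
  have hsq : CFC.sqrt S * (CFC.sqrt S).transpose = S := by
    rw [transpose_sqrt, sqrt_mul_sqrt hS.posSemidef]
  have hd := det_ne_zero_of_mul_transpose hS hsq
  have ht : Measurable fun x : Fin n → Vec M => (muHat x, sigmaHat x) :=
    continuous_muHat.measurable.prodMk continuous_sigmaHat.measurable
  have hms : MeasurableSet {p : Vec M × Mat M | p.2.PosDef} := measurable_snd measurableSet_posDef
  have hst : Measurable (ssmStatistic n m (CFC.sqrt S)) := by
    have h1 := measurable_congr (CFC.sqrt S)
    have h2 := (Matrix.toEuclideanLin (CFC.sqrt S)).continuous_of_finiteDimensional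
    unfold ssmStatistic
    fun_prop
  have h : ∀ᵐ t ∂((sampleLaw M n m S).map fun x => (muHat x, sigmaHat x)), t.2.PosDef := by
    rw [map_muHat_sigmaHat_sampleLaw (by omega) m hS hsq, ae_map_iff hst.aemeasurable hms]
    filter_upwards [ae_posDef_pivotLaw hn] with p hp using posDef_congr hp hd
  exact (ae_map_iff ht.aemeasurable hms).1 h

/-! ### The distribution of the parameters -/

/-- The matrix square root is measurable: on the cone of positive semidefinite matrices it is the
inverse of the injective continuous map `A ↦ A²`, elsewhere it is zero by convention. -/
lemma measurable_sqrt_mat : Measurable fun V : Mat M => CFC.sqrt V := by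
  have hP : MeasurableSet {V : Mat M | V.PosSemidef} := isClosed_posSemidef.measurableSet
  have hpsd (V : Mat M) : (CFC.sqrt V).PosSemidef :=
    Matrix.nonneg_iff_posSemidef.1 (CFC.sqrt_nonneg V)
  have h0 {V : Mat M} (hV : ¬ V.PosSemidef) : CFC.sqrt V = 0 := by
    rw [CFC.sqrt, cfcₙ_apply_of_not_predicate]
    change ¬ (V - 0).PosSemidef
    simpa
  have hinj : Set.InjOn (fun A : Mat M => A * A) {V : Mat M | V.PosSemidef} := by
    intro A hA B hB hAB
    have hA' : CFC.sqrt (A * A) = A :=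
      CFC.sqrt_mul_self A (Matrix.nonneg_iff_posSemidef.2 hA)
    have hB' : CFC.sqrt (B * B) = B :=
      CFC.sqrt_mul_self B (Matrix.nonneg_iff_posSemidef.2 hB)
    rw [← hA', ← hB']
    exact congrArg _ hAB
  have hpolish : PolishSpace (Mat M) := inferInstanceAs (PolishSpace (Fin M → Fin M → ℝ))
  intro E hE
  have himg : MeasurableSet ((fun A : Mat M => A * A) '' (E ∩ {V : Mat M | V.PosSemidef})) := by
    refine (hE.inter hP).image_of_continuousOn_injOn ?_ (hinj.mono Set.inter_subset_right)
    exact (by fun_prop : Continuous fun A : Mat M => A * A).continuousOn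
  have hset : (fun V : Mat M => CFC.sqrt V) ⁻¹' E =
      ((fun A : Mat M => A * A) '' (E ∩ {V : Mat M | V.PosSemidef})) ∪
        ({V : Mat M | V.PosSemidef}ᶜ ∩ {_V | (0 : Mat M) ∈ E}) := by
    ext V
    simp only [Set.mem_preimage, Set.mem_union, Set.mem_image, Set.mem_inter_iff,
      Set.mem_compl_iff]
    constructor
    · intro hV
      by_cases hVp : V.PosSemidef
      · exact Or.inl ⟨CFC.sqrt V, ⟨hV, hpsd V⟩, sqrt_mul_sqrt hVp⟩
      · exact Or.inr ⟨hVp, by rwa [h0 hVp] at hV⟩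
    · rintro (⟨A, ⟨hA, hAp⟩, rfl⟩ | ⟨hV, hE0⟩)
      · rwa [CFC.sqrt_mul_self A (Matrix.nonneg_iff_posSemidef.2 hAp)]
      · rwa [h0 hV]
  rw [hset]
  exact himg.union (hP.compl.inter (MeasurableSet.const _))

lemma measurable_mulVec {X : Type*} [MeasurableSpace X] {A : X → Mat M} {v : X → Vec M}
    (hA : Measurable A) (hv : Measurable v) :
    Measurable fun x => Matrix.toEuclideanLin (A x) (v x) := by
  have h : ∀ i, Measurable fun x => (v x).ofLp i := fun i => by fun_prop
  have h' : ∀ i j, Measurable fun x => A x i j := fun i j =>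
    measurable_pi_iff.1 (measurable_pi_iff.1 hA i) j
  simp only [Matrix.toLpLin_apply]
  refine (WithLp.measurable_toLp 2 (Fin M → ℝ)).comp (measurable_pi_iff.2 fun i => ?_)
  simp only [dotProduct, Matrix.mulVec]
  fun_prop

lemma measurable_ssmRoot (Shat : Mat M) : Measurable (ssmRoot Shat) := by
  have h : Measurable fun V : Mat M => Shat * V := by
    have : Continuous fun V : Mat M => Shat * V := by fun_prop
    exact this.measurable
  exact h.comp (measurable_sqrt_mat.comp measurable_inv_mat)

lemma measurable_ssmSolution (mhat : Vec M) (Shat : Mat M) :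
    Measurable (ssmSolution n mhat Shat) := by
  have h1 := measurable_mulVec ((measurable_ssmRoot Shat).comp measurable_snd)
    (measurable_fst (α := Vec M) (β := Mat M))
  have h2 : Measurable fun p : Vec M × Mat M => Shat * p.2⁻¹ * Shat.transpose :=
    ((measurable_congr Shat).comp measurable_inv_mat).comp measurable_snd
  have h3 : Measurable fun p : Vec M × Mat M =>
      mhat - (√n : ℝ)⁻¹ • Matrix.toEuclideanLin (ssmRoot Shat p.2) p.1 :=
    (h1.const_smul (√n : ℝ)⁻¹).const_sub mhat
  exact h3.prodMk h2

lemma ssmRoot_mul_transpose {U : Mat M} (hU : U.PosDef) (Shat : Mat M) :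
    ssmRoot Shat U * (ssmRoot Shat U).transpose = Shat * U⁻¹ * Shat.transpose := by
  rw [ssmRoot, Matrix.transpose_mul, transpose_sqrt]
  calc _ = Shat * (CFC.sqrt U⁻¹ * CFC.sqrt U⁻¹) * Shat.transpose := by
        simp only [Matrix.mul_assoc]
    _ = _ := by rw [sqrt_mul_sqrt hU.inv.posSemidef]

/-- The pivotal equations are solved by `ssmSolution`. -/
lemma ssmStatistic_ssmSolution {U : Mat M} (hU : U.PosDef) (mhat z : Vec M) (Shat : Mat M) :
    ssmStatistic n (ssmSolution n mhat Shat (z, U)).1 (ssmRoot Shat U) (z, U) =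
      (mhat, Shat * Shat.transpose) := by
  have hs := sqrt_mul_sqrt hU.inv.posSemidef
  have h1 : CFC.sqrt U⁻¹ * (CFC.sqrt U⁻¹ * U) = 1 := by
    rw [← Matrix.mul_assoc, hs, (posDef_mul_inv hU).2]
  have h2 : CFC.sqrt U⁻¹ * U * CFC.sqrt U⁻¹ = 1 := mul_eq_one_comm.1 h1
  refine Prod.ext (by simp [ssmStatistic, ssmSolution]) ?_
  simp only [ssmStatistic, ssmRoot, Matrix.transpose_mul, transpose_sqrt]
  calc _ = Shat * (CFC.sqrt U⁻¹ * U * CFC.sqrt U⁻¹) * Shat.transpose := by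
        simp only [Matrix.mul_assoc]
    _ = _ := by rw [h2, Matrix.mul_one]

lemma measurable_invWishartDensity (Psi : Mat M) (ν : ℝ) :
    Measurable (invWishartDensity Psi ν) := by
  unfold invWishartDensity
  have h : Measurable fun S : Mat M => etr (-(1 / 2 : ℝ) • (Psi * S⁻¹)) := by
    have : Continuous fun V : Mat M => etr (-(1 / 2 : ℝ) • (Psi * V)) := by
      simp only [etr]
      fun_prop
    exact this.measurable.comp measurable_inv_mat
  exact ((measurable_det.pow_const _).const_mul _).mul h

/-- If `U` has a Wishart law then `Ŝ U⁻¹ Ŝᵀ` has an inverse Wishart law. -/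
theorem lintegral_wishart_inv (h : M ≤ k) {Psi Shat : Mat M} (hPsi : Psi.PosDef)
    (hS : Shat * Shat.transpose = Psi) {f : Mat M → ENNReal} (hf : Measurable f) :
    ∫⁻ U, f (Shat * U⁻¹ * Shat.transpose) ∂(wishart 1 k) =
      ∫⁻ S, f S ∂(invWishart Psi k) := by
  obtain ⟨hg, -⟩ := multiGamma_half h
  have hd := det_ne_zero_of_mul_transpose hPsi hS
  have hu : IsUnit Shat.det := isUnit_iff_ne_zero.2 hd
  have hw := measurable_wishart_density (M := M) ((k : ℝ) / 2) (-(1 / 2))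
  have hfS : Measurable fun U : Mat M => f (Shat * U⁻¹ * Shat.transpose) :=
    (hf.fun_comp (measurable_congr Shat)).fun_comp measurable_inv_mat
  have hdens := (measurable_invWishartDensity Psi (k : ℝ)).ennreal_ofReal
  -- the density with respect to the invariant measure
  set F : Mat M → ENNReal := fun S => ENNReal.ofReal (S.det ^ (((M : ℝ) + 1) / 2)) *
    (ENNReal.ofReal (invWishartDensity Psi k S) * f S) with hF
  have hFm : Measurable F := (measurable_det_rpow _).mul (hdens.mul hf)
  rw [lintegral_wishart_eq h hfS, invWishart,
    lintegral_withDensity_eq_lintegral_mul _ hdens hf, lintegral_posDefLebesgue (hdens.mul hf)]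
  change _ = ∫⁻ S, F S ∂(invMeasure M)
  rw [← isCongrInvariant_invMeasure.lintegral_congr _ hd _ hFm, ← lintegral_inv_invMeasure
    (hFm.fun_comp (measurable_congr Shat)), ← lintegral_const_mul _ (hw.fun_mul hfS)]
  refine lintegral_congr_ae ?_
  filter_upwards [ae_posDef_invMeasure] with U hU
  have hU0 := hU.det_pos
  have hP0 := hPsi.det_pos
  have hdet : (Shat * U⁻¹ * Shat.transpose).det = Psi.det * U.det⁻¹ := by
    rw [← hS, Matrix.det_mul, Matrix.det_mul, Matrix.det_mul, Matrix.det_nonsing_inv,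
      Ring.inverse_eq_inv']
    ring
  have htr : (Psi * (Shat * U⁻¹ * Shat.transpose)⁻¹).trace = U.trace := by
    rw [Matrix.mul_inv_rev, Matrix.mul_inv_rev,
      Matrix.nonsing_inv_nonsing_inv _ (isUnit_iff_ne_zero.2 hU0.ne'), ← hS]
    have h1 : Shat.transpose * Shat.transpose⁻¹ = 1 :=
      Matrix.mul_nonsing_inv _ (by rwa [Matrix.det_transpose])
    calc _ = (Shat * (Shat.transpose * Shat.transpose⁻¹) * U * Shat⁻¹).trace := by
          simp only [Matrix.mul_assoc]
      _ = _ := by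
          rw [h1, Matrix.mul_one, Matrix.trace_mul_comm, ← Matrix.mul_assoc,
            Matrix.nonsing_inv_mul _ hu, Matrix.one_mul]
  have he : 0 < etr ((-(1 / 2) : ℝ) • U) := Real.exp_pos _
  simp only [hF]
  rw [← mul_assoc, ← mul_assoc, ← ENNReal.ofReal_mul (by positivity),
    ← ENNReal.ofReal_mul (by rw [hdet]; positivity)]
  congr 2
  rw [invWishartDensity, etr, etr, Matrix.trace_smul, Matrix.trace_smul, htr, hdet,
    Real.mul_rpow hP0.le (by positivity), Real.mul_rpow hP0.le (by positivity),
    Real.inv_rpow hU0.le, Real.inv_rpow hU0.le]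
  have e1 : Psi.det ^ (-(((k : ℝ) + M + 1) / 2)) =
      (Psi.det ^ (((M : ℝ) + 1) / 2))⁻¹ * (Psi.det ^ ((k : ℝ) / 2))⁻¹ := by
    rw [← Real.rpow_neg hP0.le, ← Real.rpow_neg hP0.le, ← Real.rpow_add hP0]
    congr 1; ring
  have e2 : (U.det ^ (-(((k : ℝ) + M + 1) / 2)))⁻¹ =
      U.det ^ (((M : ℝ) + 1) / 2) * U.det ^ ((k : ℝ) / 2) := by
    rw [← Real.rpow_neg hU0.le, ← Real.rpow_add hU0]
    congr 1; ring
  rw [e1, e2]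
  have p1 := Real.rpow_pos_of_pos hP0 (((M : ℝ) + 1) / 2)
  have p2 := Real.rpow_pos_of_pos hP0 ((k : ℝ) / 2)
  have p3 := Real.rpow_pos_of_pos hU0 (((M : ℝ) + 1) / 2)
  have p4 := Real.rpow_pos_of_pos (two_pos (α := ℝ)) ((M : ℝ) * k / 2)
  field_simp

lemma cast_pred (hn : M < n) : ((n - 1 : ℕ) : ℝ) = (n : ℝ) - 1 := by
  rw [Nat.cast_sub (by omega), Nat.cast_one]

lemma lintegral_invWishartDensity (h : M ≤ k) {Psi : Mat M} (hPsi : Psi.PosDef) :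
    ∫⁻ S, ENNReal.ofReal (invWishartDensity Psi k S) ∂(posDefLebesgue M) = 1 := by
  have hsq : CFC.sqrt Psi * (CFC.sqrt Psi).transpose = Psi := by
    rw [transpose_sqrt, sqrt_mul_sqrt hPsi.posSemidef]
  have := lintegral_wishart_inv h hPsi hsq (f := fun _ => 1) measurable_const
  simp only [lintegral_const, measure_univ, mul_one, one_mul] at this
  rw [this, invWishart, withDensity_apply _ MeasurableSet.univ, Measure.restrict_univ]

/-- The conditional law of the mean given the covariance. -/
def condMeanKernel (n : ℕ) (mhat : Vec M) : Kernel (Mat M) (Vec M) where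
  toFun S := multivariateGaussian mhat ((n : ℝ)⁻¹ • S)
  measurable' := by
    have hg : Measurable fun p : Mat M × Vec M =>
        mhat + Matrix.toEuclideanLin (CFC.sqrt ((n : ℝ)⁻¹ • p.1)) p.2 := by
      have h1 : Measurable fun V : Mat M => (n : ℝ)⁻¹ • V := by
        have : Continuous fun V : Mat M => (n : ℝ)⁻¹ • V := by fun_prop
        exact this.measurable
      exact (measurable_mulVec (measurable_sqrt_mat.comp (h1.comp measurable_fst))
        measurable_snd).const_add mhat
    refine Measure.measurable_of_measurable_coe _ fun E hE => ?_
    have h2 (S : Mat M) : multivariateGaussian mhat ((n : ℝ)⁻¹ • S) E =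
        stdGaussian (Vec M) (Prod.mk S ⁻¹' ((fun p : Mat M × Vec M =>
          mhat + Matrix.toEuclideanLin (CFC.sqrt ((n : ℝ)⁻¹ • p.1)) p.2) ⁻¹' E)) :=
      Measure.map_apply (hg.comp measurable_prodMk_left) hE
    simp_rw [h2]
    exact measurable_measure_prodMk_left (hg hE)

instance instIsMarkovKernelCondMeanKernel (n : ℕ) (mhat : Vec M) :
    IsMarkovKernel (condMeanKernel n mhat) :=
  ⟨fun S => inferInstanceAs (IsProbabilityMeasure (multivariateGaussian mhat ((n : ℝ)⁻¹ • S)))⟩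

lemma posDef_inv_smul (hn : n ≠ 0) {S : Mat M} (hS : S.PosDef) : ((n : ℝ)⁻¹ • S).PosDef :=
  hS.smul (by positivity)

/-- Disintegration of the law of the parameters along the covariance. -/
theorem lintegral_ssmLaw (hn : M < n) (mhat : Vec M) {Psi Shat : Mat M} (hPsi : Psi.PosDef)
    (hS : Shat * Shat.transpose = Psi) {f : Vec M × Mat M → ENNReal} (hf : Measurable f) :
    ∫⁻ θ, f θ ∂(ssmLaw n mhat Shat) =
      ∫⁻ S, ∫⁻ m, f (m, S) ∂(condMeanKernel n mhat S) ∂(invWishart Psi ((n : ℝ) - 1)) := by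
  have hn0 : n ≠ 0 := by omega
  have hd := det_ne_zero_of_mul_transpose hPsi hS
  have hsol := measurable_ssmSolution (n := n) mhat Shat
  have hF : Measurable fun S : Mat M => ∫⁻ m, f (m, S) ∂(condMeanKernel n mhat S) :=
    (hf.comp measurable_swap).lintegral_kernel_prod_right'
  rw [ssmLaw, lintegral_map hf hsol, pivotLaw,
    lintegral_prod_symm' _ (hf.fun_comp hsol), ← cast_pred hn,
    ← lintegral_wishart_inv (by omega) hPsi hS hF]
  refine lintegral_congr_ae ?_
  filter_upwards [ae_posDef_wishart (M := M) (k := n - 1) (by omega)] with U hU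
  have hSig : (Shat * U⁻¹ * Shat.transpose).PosDef := posDef_congr hU.inv hd
  have hAA : ((-(√n : ℝ)⁻¹) • ssmRoot Shat U) * ((-(√n : ℝ)⁻¹) • ssmRoot Shat U).transpose =
      (n : ℝ)⁻¹ • (Shat * U⁻¹ * Shat.transpose) := by
    rw [Matrix.transpose_smul, Matrix.smul_mul, Matrix.mul_smul, smul_smul,
      ssmRoot_mul_transpose hU]
    congr 1
    rw [neg_mul_neg, ← mul_inv, Real.mul_self_sqrt (Nat.cast_nonneg n)]
  have hN := map_stdGaussian_eq_multivariateGaussian (posDef_inv_smul hn0 hSig) hAA mhat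
  change _ = ∫⁻ m, f (m, Shat * U⁻¹ * Shat.transpose) ∂(multivariateGaussian mhat
    ((n : ℝ)⁻¹ • (Shat * U⁻¹ * Shat.transpose)))
  have hc := (Matrix.toEuclideanLin
    ((-(√n : ℝ)⁻¹) • ssmRoot Shat U)).continuous_of_finiteDimensional
  rw [← hN, lintegral_map (hf.fun_comp measurable_prodMk_right) (by fun_prop)]
  refine lintegral_congr fun z => ?_
  simp only [ssmSolution, map_smul, LinearMap.smul_apply]
  congr 2
  rw [neg_smul, sub_eq_add_neg]

lemma map_snd_ssmLaw (hn : M < n) (mhat : Vec M) {Psi Shat : Mat M} (hPsi : Psi.PosDef)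
    (hS : Shat * Shat.transpose = Psi) :
    (ssmLaw n mhat Shat).map Prod.snd = invWishart Psi ((n : ℝ) - 1) := by
  refine Measure.ext_of_lintegral _ fun f hf => ?_
  rw [lintegral_map hf measurable_snd, lintegral_ssmLaw hn mhat hPsi hS
    (hf.fun_comp measurable_snd)]
  simp

lemma isProbabilityMeasure_ssmLaw (mhat : Vec M) (Shat : Mat M) :
    IsProbabilityMeasure (ssmLaw n mhat Shat) := by
  unfold ssmLaw pivotLaw
  exact Measure.isProbabilityMeasure_map (measurable_ssmSolution mhat Shat).aemeasurable

theorem condDistrib_ssmLaw (hn : M < n) (mhat : Vec M) {Psi Shat : Mat M} (hPsi : Psi.PosDef)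
    (hS : Shat * Shat.transpose = Psi) :
    ∀ᵐ S ∂(invWishart Psi ((n : ℝ) - 1)),
      condDistrib Prod.fst Prod.snd (ssmLaw n mhat Shat) S =
        multivariateGaussian mhat ((n : ℝ)⁻¹ • S) := by
  have hmap := map_snd_ssmLaw hn mhat hPsi hS
  have hprob := isProbabilityMeasure_ssmLaw (n := n) mhat Shat
  have hsf : SFinite (invWishart Psi ((n : ℝ) - 1)) := by
    unfold invWishart
    infer_instance
  have := condDistrib_ae_eq_of_measure_eq_compProd (μ := ssmLaw n mhat Shat) (Y := Prod.fst)
    Prod.snd measurable_fst.aemeasurable (κ := condMeanKernel n mhat) (by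
      rw [hmap]
      refine Measure.ext_of_lintegral _ fun f hf => ?_
      rw [lintegral_map hf (by fun_prop), Measure.lintegral_compProd hf,
        lintegral_ssmLaw hn mhat hPsi hS (f := fun θ => f (θ.2, θ.1)) (by fun_prop)])
  rw [hmap] at this
  exact this

theorem ssmLaw_eq_withDensity (hn : M < n) (mhat : Vec M) {Psi Shat : Mat M} (hPsi : Psi.PosDef)
    (hS : Shat * Shat.transpose = Psi) :
    ssmLaw n mhat Shat = (paramLebesgue M).withDensity fun θ => ENNReal.ofReal
      (gaussDensity mhat ((n : ℝ)⁻¹ • θ.2) θ.1 * invWishartDensity Psi ((n : ℝ) - 1) θ.2) := by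
  have hn0 : n ≠ 0 := by omega
  have hsm : Measurable fun θ : Vec M × Mat M => (n : ℝ)⁻¹ • θ.2 := by
    have : Continuous fun θ : Vec M × Mat M => (n : ℝ)⁻¹ • θ.2 := by fun_prop
    exact this.measurable
  have hg : Measurable fun θ : Vec M × Mat M => gaussDensity mhat ((n : ℝ)⁻¹ • θ.2) θ.1 :=
    measurable_gaussDensity measurable_const hsm measurable_fst
  have hiw := measurable_invWishartDensity Psi ((n : ℝ) - 1)
  have hdens : Measurable fun θ : Vec M × Mat M => ENNReal.ofReal
      (gaussDensity mhat ((n : ℝ)⁻¹ • θ.2) θ.1 * invWishartDensity Psi ((n : ℝ) - 1) θ.2) :=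
    (hg.mul (hiw.comp measurable_snd)).ennreal_ofReal
  refine Measure.ext_of_lintegral _ fun f hf => ?_
  have hF : Measurable fun S : Mat M => ∫⁻ m, f (m, S) ∂(condMeanKernel n mhat S) :=
    (hf.comp measurable_swap).lintegral_kernel_prod_right'
  rw [lintegral_ssmLaw hn mhat hPsi hS hf, invWishart,
    lintegral_withDensity_eq_lintegral_mul _ hiw.ennreal_ofReal hF,
    lintegral_withDensity_eq_lintegral_mul _ hdens hf, paramLebesgue,
    lintegral_prod_symm' _ (hdens.mul hf)]
  refine lintegral_congr_ae ?_
  filter_upwards [ae_posDef_posDefLebesgue] with S hSp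
  have hgS : Measurable fun m : Vec M => ENNReal.ofReal (gaussDensity mhat ((n : ℝ)⁻¹ • S) m) :=
    (measurable_gaussDensity measurable_const measurable_const measurable_id).ennreal_ofReal
  have hfS : Measurable fun m => f (m, S) := hf.comp measurable_prodMk_right
  simp only [Pi.mul_apply]
  change _ * ∫⁻ m, f (m, S) ∂(multivariateGaussian mhat ((n : ℝ)⁻¹ • S)) = _
  rw [multivariateGaussian_eq_withDensity (posDef_inv_smul hn0 hSp),
    lintegral_withDensity_eq_lintegral_mul _ hgS hfS, ← lintegral_const_mul _ (hgS.mul hfS)]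
  refine lintegral_congr fun m => ?_
  simp only [Pi.mul_apply]
  rw [ENNReal.ofReal_mul (gaussDensity_nonneg _ _ _), mul_left_comm, mul_assoc]

/-! ### Predictive densities -/

lemma likelihood_extend (x : Fin n → Vec M) (y m : Vec M) (S : Mat M) :
    likelihood (extend x y) m S = gaussDensity m S y * likelihood x m S := by
  rw [likelihood, Fin.prod_univ_castSucc, mul_comm]
  simp [extend, likelihood]

/-- The likelihood as the product of a Gaussian density in the mean and a function of the
covariance. -/
lemma likelihood_eq_gaussDensity_mul (hn : n ≠ 0) (x : Fin n → Vec M) (m : Vec M) {S : Mat M}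
    (hS : S.PosDef) :
    likelihood x m S = gaussDensity (muHat x) ((n : ℝ)⁻¹ • S) m *
      ((2 * Real.pi) ^ (-((M : ℝ) * ((n : ℝ) - 1) / 2)) * (n : ℝ) ^ (-((M : ℝ) / 2)) *
        S.det ^ (-(((n : ℝ) - 1) / 2)) * etr (-(1 / 2 : ℝ) • (sigmaHat x * S⁻¹))) := by
  have hn0 : (0 : ℝ) < n := by positivity
  have hd := hS.det_pos
  have hT : (0 : ℝ) < 2 * Real.pi := by positivity
  have hinv : ((n : ℝ)⁻¹ • S)⁻¹ = (n : ℝ) • S⁻¹ := by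
    refine Matrix.inv_eq_right_inv ?_
    rw [Matrix.smul_mul, Matrix.mul_smul, smul_smul, (posDef_mul_inv hS).1,
      inv_mul_cancel₀ hn0.ne', one_smul]
  have hq : (m - muHat x).ofLp ⬝ᵥ S⁻¹.mulVec (m - muHat x).ofLp =
      (muHat x - m).ofLp ⬝ᵥ S⁻¹.mulVec (muHat x - m).ofLp := by
    rw [← neg_sub (muHat x) m, WithLp.ofLp_neg, Matrix.mulVec_neg, neg_dotProduct_neg]
  rw [likelihood_eq hn, gaussDensity, hinv, Matrix.smul_mulVec, dotProduct_smul, hq,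
    Matrix.det_smul, Fintype.card_fin, etr, Matrix.trace_smul, Matrix.trace_mul_comm (sigmaHat x)]
  generalize (muHat x - m).ofLp ⬝ᵥ S⁻¹.mulVec (muHat x - m).ofLp = q
  generalize (S⁻¹ * sigmaHat x).trace = t
  generalize S.det = d at hd
  generalize 2 * Real.pi = T at hT
  -- all factors are written as exponentials
  obtain ⟨δ, rfl⟩ : ∃ δ, Real.exp δ = d := ⟨Real.log d, Real.exp_log hd⟩
  obtain ⟨τ, rfl⟩ : ∃ τ, Real.exp τ = T := ⟨Real.log T, Real.exp_log hT⟩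
  obtain ⟨ν, hν⟩ : ∃ ν, Real.exp ν = (n : ℝ) := ⟨Real.log n, Real.exp_log hn0⟩
  have hs (c : ℝ) : √(Real.exp c) = Real.exp (c / 2) := (Real.exp_half c).symm
  have h1 : √(Real.exp τ ^ M * Real.exp δ) ^ n = Real.exp (n * ((M * τ + δ) / 2)) := by
    rw [← Real.exp_nat_mul, ← Real.exp_add, hs, ← Real.exp_nat_mul]
  have h2 : √(Real.exp τ ^ M * ((n : ℝ)⁻¹ ^ M * Real.exp δ)) =
      Real.exp ((M * τ + (M * -ν + δ)) / 2) := by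
    rw [← hν, ← Real.exp_neg, ← Real.exp_nat_mul, ← Real.exp_nat_mul, ← Real.exp_add,
      ← Real.exp_add, hs]
  have h3 : (n : ℝ) ^ (-((M : ℝ) / 2)) = Real.exp (ν * -((M : ℝ) / 2)) := by
    rw [← hν, Real.exp_mul]
  rw [h1, h2, h3, ← Real.exp_mul, ← Real.exp_mul, one_div (Real.exp _), ← Real.exp_neg,
    ← Real.exp_neg]
  simp only [← Real.exp_add, smul_eq_mul]
  congr 1
  ring

/-- The total mass of the likelihood of `n` observations with scatter matrix `Psi` against
`det(Σ)^a dμ dΣ`, where the weight exponent `a` is tied to `k` by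
`(n - 1) / 2 - a = (k + M + 1) / 2`. -/
def likelihoodMass (n k : ℕ) (Psi : Mat M) : ℝ :=
  (2 * Real.pi) ^ (-((M : ℝ) * ((n : ℝ) - 1) / 2)) * (n : ℝ) ^ (-((M : ℝ) / 2)) *
    (2 ^ ((M : ℝ) * k / 2) * multiGamma M ((k : ℝ) / 2) * Psi.det ^ (-((k : ℝ) / 2)))

lemma likelihoodMass_pos (hn : n ≠ 0) (h : M ≤ k) {Psi : Mat M} (hPsi : Psi.PosDef) :
    0 < likelihoodMass n k Psi := by
  have h1 := (multiGamma_half h).1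
  have h2 := hPsi.det_pos
  unfold likelihoodMass
  positivity

/-- The likelihood, weighted by a power of the determinant of the covariance, is a multiple of the
normal-inverse-Wishart density. -/
lemma likelihood_mul_det_rpow (hn : n ≠ 0) (h : M ≤ k) {a : ℝ}
    (ha : ((n : ℝ) - 1) / 2 - a = ((k : ℝ) + M + 1) / 2) {x : Fin n → Vec M}
    (hx : (sigmaHat x).PosDef) (m : Vec M) {S : Mat M} (hS : S.PosDef) :
    likelihood x m S * S.det ^ a = likelihoodMass n k (sigmaHat x) *
      (gaussDensity (muHat x) ((n : ℝ)⁻¹ • S) m * invWishartDensity (sigmaHat x) k S) := by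
  have hg := (multiGamma_half h).1
  have hd := hS.det_pos
  have hP := hx.det_pos
  have e1 : S.det ^ (-(((n : ℝ) - 1) / 2)) * S.det ^ a = S.det ^ (-(((k : ℝ) + M + 1) / 2)) := by
    rw [← Real.rpow_add hd, ← ha]
    congr 1
    ring
  have p1 := Real.rpow_pos_of_pos hP ((k : ℝ) / 2)
  have p2 := Real.rpow_pos_of_pos (two_pos (α := ℝ)) ((M : ℝ) * k / 2)
  rw [likelihood_eq_gaussDensity_mul hn x m hS, likelihoodMass, invWishartDensity, ← e1,
    Real.rpow_neg hP.le]
  field_simp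

lemma lintegral_likelihood (hn : n ≠ 0) (h : M ≤ k) {a : ℝ}
    (ha : ((n : ℝ) - 1) / 2 - a = ((k : ℝ) + M + 1) / 2) {x : Fin n → Vec M}
    (hx : (sigmaHat x).PosDef) :
    ∫⁻ θ, ENNReal.ofReal (likelihood x θ.1 θ.2 * θ.2.det ^ a) ∂(paramLebesgue M) =
      ENNReal.ofReal (likelihoodMass n k (sigmaHat x)) := by
  have hm : Measurable fun θ : Vec M × Mat M =>
      ENNReal.ofReal (likelihood x θ.1 θ.2 * θ.2.det ^ a) :=
    ((measurable_likelihood measurable_const measurable_fst measurable_snd).mul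
      ((measurable_det.comp measurable_snd).pow_const a)).ennreal_ofReal
  have hc := likelihoodMass_pos hn h hx
  rw [paramLebesgue, lintegral_prod_symm' _ hm, ← mul_one (ENNReal.ofReal (likelihoodMass _ _ _)),
    ← lintegral_invWishartDensity h hx,
    ← lintegral_const_mul _ (measurable_invWishartDensity _ _).ennreal_ofReal]
  refine lintegral_congr_ae ?_
  filter_upwards [ae_posDef_posDefLebesgue] with S hS
  have hgS : Measurable fun m : Vec M =>
      ENNReal.ofReal (gaussDensity (muHat x) ((n : ℝ)⁻¹ • S) m) :=
    (measurable_gaussDensity measurable_const measurable_const measurable_id).ennreal_ofReal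
  rw [← mul_one (ENNReal.ofReal (likelihoodMass _ _ _) * _),
    ← lintegral_gaussDensity (posDef_inv_smul hn hS) (muHat x), ← lintegral_const_mul _ hgS]
  refine lintegral_congr fun m => ?_
  rw [likelihood_mul_det_rpow hn h ha hx m hS, ENNReal.ofReal_mul hc.le,
    ENNReal.ofReal_mul (gaussDensity_nonneg _ _ _), mul_left_comm, mul_comm (ENNReal.ofReal
      (gaussDensity _ _ _))]

lemma likelihood_nonneg (x : Fin n → Vec M) (m : Vec M) (S : Mat M) : 0 ≤ likelihood x m S :=
  Finset.prod_nonneg fun _ _ => gaussDensity_nonneg _ _ _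

lemma ae_posDef_paramLebesgue : ∀ᵐ θ ∂(paramLebesgue M), θ.2.PosDef :=
  Measure.quasiMeasurePreserving_snd.ae ae_posDef_posDefLebesgue

lemma integrable_likelihood (hn : n ≠ 0) (h : M ≤ k) {a : ℝ}
    (ha : ((n : ℝ) - 1) / 2 - a = ((k : ℝ) + M + 1) / 2) {x : Fin n → Vec M}
    (hx : (sigmaHat x).PosDef) :
    Integrable (fun θ : Vec M × Mat M => likelihood x θ.1 θ.2 * θ.2.det ^ a) (paramLebesgue M) ∧
      ∫ θ, likelihood x θ.1 θ.2 * θ.2.det ^ a ∂(paramLebesgue M) =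
        likelihoodMass n k (sigmaHat x) := by
  have hm : Measurable fun θ : Vec M × Mat M => likelihood x θ.1 θ.2 * θ.2.det ^ a :=
    (measurable_likelihood measurable_const measurable_fst measurable_snd).mul
      ((measurable_det.comp measurable_snd).pow_const a)
  have h0 : 0 ≤ᵐ[paramLebesgue M] fun θ => likelihood x θ.1 θ.2 * θ.2.det ^ a := by
    filter_upwards [ae_posDef_paramLebesgue] with θ hθ
    exact mul_nonneg (likelihood_nonneg _ _ _) (Real.rpow_nonneg hθ.det_pos.le _)
  have hI := lintegral_likelihood hn h ha hx
  constructor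
  · rw [← lintegral_ofReal_ne_top_iff_integrable hm.aestronglyMeasurable h0, hI]
    exact ENNReal.ofReal_ne_top
  · rw [integral_eq_lintegral_of_nonneg_ae h0 hm.aestronglyMeasurable, hI,
      ENNReal.toReal_ofReal (likelihoodMass_pos hn h hx).le]

/-- Multiplying the likelihood by the density of another observation raises both `n` and `k` by one,
with the same weight exponent. -/
lemma integrable_predictive (hn : n ≠ 0) (h : M ≤ k) {a : ℝ}
    (ha : ((n : ℝ) - 1) / 2 - a = ((k : ℝ) + M + 1) / 2) {x : Fin n → Vec M}
    (hx : (sigmaHat x).PosDef) (y : Vec M) (C : ℝ) :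
    Integrable (fun θ : Vec M × Mat M =>
        gaussDensity θ.1 θ.2 y * (likelihood x θ.1 θ.2 * θ.2.det ^ a / C)) (paramLebesgue M) ∧
      ∫ θ, gaussDensity θ.1 θ.2 y * (likelihood x θ.1 θ.2 * θ.2.det ^ a / C) ∂(paramLebesgue M) =
        likelihoodMass (n + 1) (k + 1) (sigmaHat (extend x y)) / C := by
  obtain ⟨h1, h2⟩ := integrable_likelihood (n := n + 1) (k := k + 1) (a := a) (by omega) (by omega)
    (by push_cast; linarith) (posDef_sigmaHat_extend hx hn y)
  have he : (fun θ : Vec M × Mat M =>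
      gaussDensity θ.1 θ.2 y * (likelihood x θ.1 θ.2 * θ.2.det ^ a / C)) =
      fun θ => likelihood (extend x y) θ.1 θ.2 * θ.2.det ^ a / C := by
    ext θ
    rw [likelihood_extend]
    ring
  rw [he, integral_div, h2]
  exact ⟨h1.div_const C, rfl⟩

lemma likelihoodMass_div (hn : n ≠ 0) (h : M ≤ k) {Psi Psi' : Mat M} (hPsi : Psi.PosDef)
    (hPsi' : Psi'.PosDef) :
    likelihoodMass (n + 1) (k + 1) Psi' / likelihoodMass n k Psi =
      Real.pi ^ (-((M : ℝ) / 2)) * ((n : ℝ) / ((n : ℝ) + 1)) ^ ((M : ℝ) / 2) *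
        (Psi.det ^ ((k : ℝ) / 2) / Psi'.det ^ (((k : ℝ) + 1) / 2)) *
        (multiGamma M (((k : ℝ) + 1) / 2) / multiGamma M ((k : ℝ) / 2)) := by
  have hg := (multiGamma_half h).1
  have hd := hPsi.det_pos
  have hd' := hPsi'.det_pos
  have hn0 : (0 : ℝ) < n := by positivity
  have hpi := Real.pi_pos
  have h2pi : (0 : ℝ) < 2 * Real.pi := by positivity
  have e1 : (2 * Real.pi) ^ (-((M : ℝ) * ((n : ℝ) + 1 - 1) / 2)) =
      (2 * Real.pi) ^ (-((M : ℝ) * ((n : ℝ) - 1) / 2)) *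
        ((2 ^ ((M : ℝ) / 2))⁻¹ * Real.pi ^ (-((M : ℝ) / 2))) := by
    rw [← Real.rpow_neg zero_le_two, ← Real.mul_rpow zero_le_two hpi.le, ← Real.rpow_add h2pi]
    congr 1
    ring
  have e2 : (2 : ℝ) ^ ((M : ℝ) * ((k : ℝ) + 1) / 2) =
      2 ^ ((M : ℝ) * k / 2) * 2 ^ ((M : ℝ) / 2) := by
    rw [← Real.rpow_add two_pos]
    congr 1
    ring
  simp only [likelihoodMass, Nat.cast_add, Nat.cast_one]
  rw [e1, e2, Real.div_rpow hn0.le (by positivity), Real.rpow_neg hd.le, Real.rpow_neg hd'.le,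
    Real.rpow_neg hn0.le, Real.rpow_neg (by positivity : (0 : ℝ) ≤ n + 1)]
  have p1 := Real.rpow_pos_of_pos hd ((k : ℝ) / 2)
  have p2 := Real.rpow_pos_of_pos hd' (((k : ℝ) + 1) / 2)
  have p3 := Real.rpow_pos_of_pos hn0 ((M : ℝ) / 2)
  have p4 := Real.rpow_pos_of_pos (by positivity : (0 : ℝ) < n + 1) ((M : ℝ) / 2)
  have p5 := Real.rpow_pos_of_pos (two_pos (α := ℝ)) ((M : ℝ) / 2)
  have p6 := Real.rpow_pos_of_pos (two_pos (α := ℝ)) ((M : ℝ) * k / 2)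
  have p7 := Real.rpow_pos_of_pos h2pi (-((M : ℝ) * ((n : ℝ) - 1) / 2))
  field_simp

lemma invWishartDensity_nonneg (h : M ≤ k) {Psi S : Mat M} (hPsi : Psi.PosDef) (hS : S.PosDef) :
    0 ≤ invWishartDensity Psi k S := by
  have := (multiGamma_half h).1
  have := hPsi.det_pos
  have := hS.det_pos
  have := etr_nonneg (-(1 / 2 : ℝ) • (Psi * S⁻¹))
  unfold invWishartDensity
  positivity

theorem ssmPredictive_eq (hn : M < n) {x : Fin n → Vec M} {Shat : Mat M}
    (hx : (sigmaHat x).PosDef) (hS : Shat * Shat.transpose = sigmaHat x) (y : Vec M) :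
    Integrable (fun θ => gaussDensity θ.1 θ.2 y) (ssmLaw n (muHat x) Shat) ∧
      ssmPredictive n (muHat x) Shat y =
        Real.pi ^ (-((M : ℝ) / 2)) * ((n : ℝ) / ((n : ℝ) + 1)) ^ ((M : ℝ) / 2) *
          ((sigmaHat x).det ^ (((n : ℝ) - 1) / 2) /
            (sigmaHat (extend x y)).det ^ ((n : ℝ) / 2)) *
          (multiGamma M ((n : ℝ) / 2) / multiGamma M (((n : ℝ) - 1) / 2)) := by
  have hn0 : n ≠ 0 := by omega
  have hk : M ≤ n - 1 := by omega
  have hcast := cast_pred hn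
  have ha : ((n : ℝ) - 1) / 2 - (-(((M : ℝ) + 1) / 2)) = (((n - 1 : ℕ) : ℝ) + M + 1) / 2 := by
    rw [hcast]; ring
  obtain ⟨h1, h2⟩ := integrable_predictive hn0 hk ha hx y (likelihoodMass n (n - 1) (sigmaHat x))
  have hC := likelihoodMass_pos hn0 hk hx
  have hsm : Measurable fun θ : Vec M × Mat M => (n : ℝ)⁻¹ • θ.2 := by
    have : Continuous fun θ : Vec M × Mat M => (n : ℝ)⁻¹ • θ.2 := by fun_prop
    exact this.measurable
  have hdens : Measurable fun θ : Vec M × Mat M => ENNReal.ofReal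
      (gaussDensity (muHat x) ((n : ℝ)⁻¹ • θ.2) θ.1 *
        invWishartDensity (sigmaHat x) ((n : ℝ) - 1) θ.2) :=
    ((measurable_gaussDensity measurable_const hsm measurable_fst).mul
      ((measurable_invWishartDensity _ _).comp measurable_snd)).ennreal_ofReal
  have hae : (fun θ : Vec M × Mat M => gaussDensity θ.1 θ.2 y *
      (likelihood x θ.1 θ.2 * θ.2.det ^ (-(((M : ℝ) + 1) / 2)) /
        likelihoodMass n (n - 1) (sigmaHat x))) =ᵐ[paramLebesgue M]
      fun θ => gaussDensity θ.1 θ.2 y * (ENNReal.ofReal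
        (gaussDensity (muHat x) ((n : ℝ)⁻¹ • θ.2) θ.1 *
          invWishartDensity (sigmaHat x) ((n : ℝ) - 1) θ.2)).toReal := by
    filter_upwards [ae_posDef_paramLebesgue] with θ hθ
    have hnn := invWishartDensity_nonneg hk hx hθ
    rw [likelihood_mul_det_rpow hn0 hk ha hx θ.1 hθ, mul_div_cancel_left₀ _ hC.ne', ← hcast,
      ENNReal.toReal_ofReal (mul_nonneg (gaussDensity_nonneg _ _ _) hnn)]
  have hlaw := ssmLaw_eq_withDensity hn (muHat x) hx hS
  constructor
  · rw [hlaw, integrable_withDensity_iff hdens (Filter.Eventually.of_forall fun _ =>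
      ENNReal.ofReal_lt_top)]
    exact h1.congr hae
  · rw [ssmPredictive, hlaw, integral_withDensity_eq_integral_toReal_smul hdens
      (Filter.Eventually.of_forall fun _ => ENNReal.ofReal_lt_top)]
    simp only [smul_eq_mul, mul_comm (ENNReal.toReal _)]
    rw [← integral_congr_ae hae, h2,
      likelihoodMass_div hn0 hk hx (posDef_sigmaHat_extend hx hn0 y), hcast, sub_add_cancel]

theorem nlmPredictive_eq (hM : 2 * M + 1 < n) {x : Fin n → Vec M} (hx : (sigmaHat x).PosDef) :
    Integrable (fun θ => likelihood x θ.1 θ.2) (paramLebesgue M) ∧ 0 < nlmC x ∧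
      ∀ y : Vec M,
        Integrable (fun θ => gaussDensity θ.1 θ.2 y * nlmDensity x θ) (paramLebesgue M) ∧
        nlmPredictive x y = nlmC (extend x y) / nlmC x ∧
        nlmPredictive x y =
          Real.pi ^ (-((M : ℝ) / 2)) * ((n : ℝ) / ((n : ℝ) + 1)) ^ ((M : ℝ) / 2) *
            ((sigmaHat x).det ^ (((n : ℝ) - 1) / 2 - ((M : ℝ) + 1) / 2) /
              (sigmaHat (extend x y)).det ^ ((n : ℝ) / 2 - ((M : ℝ) + 1) / 2)) *
            (multiGamma M (((n : ℝ) - (M : ℝ) - 1) / 2) /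
              multiGamma M (((n : ℝ) - (M : ℝ) - 2) / 2)) := by
  obtain ⟨k, rfl⟩ : ∃ k, n = k + M + 2 := ⟨n - M - 2, by omega⟩
  have hn0 : k + M + 2 ≠ 0 := by omega
  have hk : M ≤ k := by omega
  have ha : (((k + M + 2 : ℕ) : ℝ) - 1) / 2 - 0 = ((k : ℝ) + M + 1) / 2 := by push_cast; ring
  obtain ⟨h1, h2⟩ := integrable_likelihood hn0 hk ha hx
  simp only [Real.rpow_zero, mul_one] at h1 h2
  have hC : nlmC x = likelihoodMass (k + M + 2) k (sigmaHat x) := h2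
  refine ⟨h1, hC ▸ likelihoodMass_pos hn0 hk hx, fun y => ?_⟩
  have hx' := posDef_sigmaHat_extend hx hn0 y
  obtain ⟨h3, h4⟩ := integrable_predictive hn0 hk ha hx y (nlmC x)
  obtain ⟨-, h5⟩ := integrable_likelihood (n := k + M + 2 + 1) (k := k + 1) (a := 0) (by omega)
    (by omega) (by push_cast; ring) hx'
  simp only [Real.rpow_zero, mul_one] at h3 h4 h5
  have hC' : nlmC (extend x y) = likelihoodMass (k + M + 2 + 1) (k + 1) (sigmaHat (extend x y)) :=
    h5
  have hp : nlmPredictive x y = likelihoodMass (k + M + 2 + 1) (k + 1) (sigmaHat (extend x y)) /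
    nlmC x := h4
  refine ⟨h3, by rw [hp, hC'], ?_⟩
  rw [hp, hC, likelihoodMass_div hn0 hk hx hx']
  have e1 : (((k + M + 2 : ℕ) : ℝ) - 1) / 2 - ((M : ℝ) + 1) / 2 = (k : ℝ) / 2 := by
    push_cast; ring
  have e2 : ((k + M + 2 : ℕ) : ℝ) / 2 - ((M : ℝ) + 1) / 2 = ((k : ℝ) + 1) / 2 := by
    push_cast; ring
  have e3 : ((k + M + 2 : ℕ) : ℝ) - (M : ℝ) - 1 = (k : ℝ) + 1 := by push_cast; ring
  have e4 : ((k + M + 2 : ℕ) : ℝ) - (M : ℝ) - 2 = (k : ℝ) := by push_cast; ring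
  rw [e1, e2, e3, e4]

end VecGauss
end

theorem mainTheorem9 (M n : ℕ) (hM : 0 < M) (hn : M < n) :
    -- the likelihood is the density of the sample, the statistic is sufficient,
    -- and the sample determines a positive definite scatter matrix almost surely
    (∀ (m : VecGauss.Vec M) (S : VecGauss.Mat M), S.PosDef →
      VecGauss.sampleLaw M n m S =
          (volume : Measure (Fin n → VecGauss.Vec M)).withDensity
            (fun x => ENNReal.ofReal (VecGauss.likelihood x m S)) ∧
        ∀ᵐ x ∂(VecGauss.sampleLaw M n m S), (VecGauss.sigmaHat x).PosDef) ∧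
    VecGauss.IsSufficient
      (fun θ : {p : VecGauss.Vec M × VecGauss.Mat M // p.2.PosDef} =>
        VecGauss.sampleLaw M n θ.1.1 θ.1.2)
      (fun x => (VecGauss.muHat x, VecGauss.sigmaHat x)) ∧
    -- the law of the statistic in terms of the pivot, for every square root of the covariance
    (∀ (m : VecGauss.Vec M) (Sigma S : VecGauss.Mat M), Sigma.PosDef →
      S * S.transpose = Sigma →
      (VecGauss.sampleLaw M n m Sigma).map
          (fun x => (VecGauss.muHat x, VecGauss.sigmaHat x)) =
        (VecGauss.pivotLaw M n).map (VecGauss.ssmStatistic n m S)) ∧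
    -- the sufficient statistic method, for every square root of the scatter matrix
    (∀ (x : Fin n → VecGauss.Vec M) (Shat : VecGauss.Mat M),
      (VecGauss.sigmaHat x).PosDef → Shat * Shat.transpose = VecGauss.sigmaHat x →
      -- the solution of the pivotal equations
      (∀ᵐ p ∂(VecGauss.pivotLaw M n),
        p.2.PosDef ∧
        (VecGauss.ssmSolution n (VecGauss.muHat x) Shat p).2.PosDef ∧
        VecGauss.ssmRoot Shat p.2 * (VecGauss.ssmRoot Shat p.2).transpose =
          (VecGauss.ssmSolution n (VecGauss.muHat x) Shat p).2 ∧
        VecGauss.ssmStatistic n (VecGauss.ssmSolution n (VecGauss.muHat x) Shat p).1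
            (VecGauss.ssmRoot Shat p.2) p =
          (VecGauss.muHat x, VecGauss.sigmaHat x)) ∧
      -- the distribution of the parameters
      IsProbabilityMeasure (VecGauss.ssmLaw n (VecGauss.muHat x) Shat) ∧
      (VecGauss.ssmLaw n (VecGauss.muHat x) Shat).map Prod.snd =
        VecGauss.invWishart (VecGauss.sigmaHat x) ((n : ℝ) - 1) ∧
      (∀ᵐ S ∂(VecGauss.invWishart (VecGauss.sigmaHat x) ((n : ℝ) - 1)),
        condDistrib Prod.fst Prod.snd (VecGauss.ssmLaw n (VecGauss.muHat x) Shat) S =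
          multivariateGaussian (VecGauss.muHat x) ((n : ℝ)⁻¹ • S)) ∧
      VecGauss.ssmLaw n (VecGauss.muHat x) Shat =
        (VecGauss.paramLebesgue M).withDensity (fun θ => ENNReal.ofReal
          (VecGauss.gaussDensity (VecGauss.muHat x) ((n : ℝ)⁻¹ • θ.2) θ.1 *
            VecGauss.invWishartDensity (VecGauss.sigmaHat x) ((n : ℝ) - 1) θ.2)) ∧
      -- the predictive density
      ∀ y : VecGauss.Vec M,
        Integrable (fun θ => VecGauss.gaussDensity θ.1 θ.2 y)
          (VecGauss.ssmLaw n (VecGauss.muHat x) Shat) ∧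
        VecGauss.ssmPredictive n (VecGauss.muHat x) Shat y =
          Real.pi ^ (-((M : ℝ) / 2)) * ((n : ℝ) / ((n : ℝ) + 1)) ^ ((M : ℝ) / 2) *
            ((VecGauss.sigmaHat x).det ^ (((n : ℝ) - 1) / 2) /
              (VecGauss.sigmaHat (VecGauss.extend x y)).det ^ ((n : ℝ) / 2)) *
            (VecGauss.multiGamma M ((n : ℝ) / 2) /
              VecGauss.multiGamma M (((n : ℝ) - 1) / 2))) ∧
    -- the normalised likelihood method
    (2 * M + 1 < n → ∀ x : Fin n → VecGauss.Vec M, (VecGauss.sigmaHat x).PosDef →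
      Integrable (fun θ => VecGauss.likelihood x θ.1 θ.2) (VecGauss.paramLebesgue M) ∧
      0 < VecGauss.nlmC x ∧
      ∀ y : VecGauss.Vec M,
        Integrable (fun θ => VecGauss.gaussDensity θ.1 θ.2 y * VecGauss.nlmDensity x θ)
          (VecGauss.paramLebesgue M) ∧
        VecGauss.nlmPredictive x y =
          VecGauss.nlmC (VecGauss.extend x y) / VecGauss.nlmC x ∧
        VecGauss.nlmPredictive x y =
          Real.pi ^ (-((M : ℝ) / 2)) * ((n : ℝ) / ((n : ℝ) + 1)) ^ ((M : ℝ) / 2) *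
            ((VecGauss.sigmaHat x).det ^ (((n : ℝ) - 1) / 2 - ((M : ℝ) + 1) / 2) /
              (VecGauss.sigmaHat (VecGauss.extend x y)).det ^
                ((n : ℝ) / 2 - ((M : ℝ) + 1) / 2)) *
            (VecGauss.multiGamma M (((n : ℝ) - (M : ℝ) - 1) / 2) /
              VecGauss.multiGamma M (((n : ℝ) - (M : ℝ) - 2) / 2))) := by
  have hn0 : n ≠ 0 := by omega
  refine ⟨fun m S hS => ⟨VecGauss.sampleLaw_eq_withDensity hS m,
      VecGauss.ae_posDef_sigmaHat hn m hS⟩, VecGauss.isSufficient_muHat_sigmaHat hn0,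
    fun m Sigma S hSig hS => VecGauss.map_muHat_sigmaHat_sampleLaw hn0 m hSig hS,
    fun x Shat hx hS => ⟨?_, VecGauss.isProbabilityMeasure_ssmLaw _ _,
      VecGauss.map_snd_ssmLaw hn _ hx hS, VecGauss.condDistrib_ssmLaw hn _ hx hS,
      VecGauss.ssmLaw_eq_withDensity hn _ hx hS, fun y => VecGauss.ssmPredictive_eq hn hx hS y⟩,
    fun hn2 x hx => VecGauss.nlmPredictive_eq hn2 hx⟩
  filter_upwards [VecGauss.ae_posDef_pivotLaw hn] with p hp
  refine ⟨hp, VecGauss.posDef_congr hp.inv (VecGauss.det_ne_zero_of_mul_transpose hx hS),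
    VecGauss.ssmRoot_mul_transpose hp Shat, ?_⟩
  rw [← hS]
  exact VecGauss.ssmStatistic_ssmSolution hp _ p.1 Shat
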